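/- Let $F$ be a non-archimedean local field of characteristic zero and odd residual characteristic, and let $E=F(\sqrt{\epsilon})$ be its unramified quadratic extension, where $\epsilon\in\mathfrak{o}_F^\times$ is a non-square. Let $x\mapsto\overline{x}$ be the non-trivial element of $\mathrm{Gal}(E/F)$, $\mathfrak{o}_E$ the ring of integers of $E$, $\mathfrak{p}_E$ its maximal ideal, $|\cdot|_E$ the normalized absolute value, and $E^1=\{a\in E^\times : a\overline{a}=1\}$. Let $$G=\{g\in \mathrm{GL}_3(E) : {}^t\overline{g}Jg=J\},\qquad J=\begin{pmatrix}0&0&1\\0&1&0\\1&0&0\end{pmatrix},$$ let $B$ be the subgroup of upper triangular elements of $G$, let $Z$ be the center of $G$, and let $\iota:E^1\to Z$ send $\lambda$ to the scalar matrix $\lambda$. For $n\ge 0$ let $$K_n=\begin{pmatrix}\mathfrak{o}_E&\mathfrak{o}_E&\mathfrak{p}_E^{-n}\\ \mathfrak{p}_E^n&1+\mathfrak{p}_E^n&\mathfrak{o}_E\\ \mathfrak{p}_E^n&\mathfrak{p}_E^n&\mathfrak{o}_E\end{pmatrix}\cap G,$$ and let $E^1_0=E^1$, $E^1_n=E^1\cap(1+\mathfrak{p}_E^n)$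 for $n\ge1$. Let $\mu_1$ be a quasi-character (continuous homomorphism to $\mathbf{C}^\times$) of $E^\times$ and $\mu_2$ a character of $E^1$. Their conductors are $$c(\mu_1)=\min\{n\ge0 : \mu_1|_{(1+\mathfrak{p}_E^n)\cap\mathfrak{o}_E^\times}=1\},\qquad c(\mu_2)=\min\{n\ge 0:\mu_2|_{E^1_n}=1\},$$ and $\mu_1$ is called unramified if $c(\mu_1)=0$. Let $\pi=\mathrm{Ind}_B^G(\mu_1\otimes\mu_2)$ be the normalized parabolic induction: the group $G$ acts by right translation on the space $V$ of locally constant functions $f:G\to\mathbf{C}$ such that $$f(bg)=\delta_B(b)^{1/2}\,\mu_1(a)\,\mu_2(d)\,f(g),\qquad \delta_B(b)=|a|_E^2,$$ for all $g\in G$ and all $b\in B$ with diagonal $(a,d,\overline{a}^{-1})$. The representation $\pi$ has a non-zero $K_n$-fixed vector for some $n\ge0$, and it has a unique central character $\omega_\pi:Z\to\mathbf{C}^\times$, so that one can put $$N_\pi=\min\{n\ge0 : V^{K_n}\ne\{0\}\},\qquad n_\pi=\min\{n\ge0:\omega_\pi|_{\iota(E^1_n)}=1\};$$ all the minima above are taken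 over non-empty sets. Then $N_\pi=n_\pi$ if and only if $\mu_1$ is unramified. In that case $N_\pi=n_\pi=c(\mu_2)$. -/

import Mathlib

open ValuativeRel
open scoped WithZero NNReal

namespace UnramifiedU3

noncomputable section

/-! ## Local fields -/

section LocalField

variable (E : Type*) [Field E] [ValuativeRel E] [TopologicalSpace E]
  [IsNonarchimedeanLocalField E]

/-- The valuation of the local field `E` with values in `ℤᵐ⁰`, written multiplicatively: it is
`exp (-ν_E(x))` for `x ≠ 0`, where `ν_E` is the valuation taking the value `1` at uniformizers.
(The ordered isomorphism of the value group with `ℤᵐ⁰` is unique.) -/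
def val (x : E) : ℤᵐ⁰ :=
  IsNonarchimedeanLocalField.valueGroupWithZeroIsoInt E (valuation E x)

/-- The fractional ideal `𝔭_E ^ n`, for an integer `n`. In particular `𝔭_E ^ 0 = 𝔬_E`. -/
def primePow (n : ℤ) : Set E := {x | val E x ≤ WithZero.exp (-n)}

/-- The cardinality `q_E` of the residue field of `E`. -/
def residueCard : ℕ := Nat.card 𝓀[E]

lemma residueCard_ne_zero : (residueCard E : ℝ≥0) ≠ 0 :=
  Nat.cast_ne_zero.mpr Nat.card_pos.ne'

/-- The normalized absolute value of `E`, with `|ϖ_E| = q_E⁻¹` at uniformizers. -/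
def normAbs (x : E) : ℝ := WithZeroMulInt.toNNReal (residueCard_ne_zero E) (val E x)

variable {E}

/-- The quasi-character `μ₁` of `Eˣ` is trivial on `(1 + 𝔭_E ^ n) ∩ 𝔬_Eˣ`. -/
def TrivialAtLevel (μ₁ : Eˣ →ₜ* ℂˣ) (n : ℕ) : Prop :=
  ∀ a : Eˣ, val E (a : E) = 1 → (a : E) - 1 ∈ primePow E n → μ₁ a = 1

/-- The conductor `c(μ₁)` of a quasi-character of `Eˣ`. -/
def conductor (μ₁ : Eˣ →ₜ* ℂˣ) : ℕ := sInf {n | TrivialAtLevel μ₁ n}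

/-- A quasi-character is unramified if its conductor is zero. -/
def Unramified (μ₁ : Eˣ →ₜ* ℂˣ) : Prop := conductor μ₁ = 0

end LocalField

/-! ## The unitary group and its subgroups

In this part `σ` is the non-trivial element of `Gal(E/F)`, that is, `σ x` is the conjugate of
`x`. -/

section Group

variable {F E : Type*} [Field F] [Field E] [Algebra F E]

/-- The norm-one subgroup `E¹` of `Eˣ`. -/
def normOne (σ : E ≃ₐ[F] E) : Subgroup Eˣ where
  carrier := {a | (a : E) * σ a = 1}
  one_mem' := by simp
  mul_mem' {a b} ha hb := by
    simp only [Set.mem_ofPred_eq, Units.val_mul, map_mul] at *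
    linear_combination ha * ((b : E) * σ b) + hb
  inv_mem' {a} ha := by
    simp only [Set.mem_ofPred_eq, Units.val_inv_eq_inv_val, map_inv₀] at *
    rw [← mul_inv, ha, inv_one]

/-- The matrix `J` of the hermitian form. -/
def formJ (E : Type*) [Field E] : Matrix (Fin 3) (Fin 3) E :=
  !![0, 0, 1; 0, 1, 0; 1, 0, 0]

/-- The unitary group `G = {g ∈ GL₃(E) | ᵗḡ J g = J}`. -/
def unitaryG (σ : E ≃ₐ[F] E) : Subgroup (GL (Fin 3) E) where
  carrier := {g | (g.val.map σ).transpose * formJ E * g.val = formJ E}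
  one_mem' := by simp [Matrix.map_one]
  mul_mem' {a b} ha hb := by
    simp only [Set.mem_ofPred_eq, Units.val_mul] at *
    rw [Matrix.map_mul, Matrix.transpose_mul]
    calc _ = (b.val.map σ).transpose * ((a.val.map σ).transpose * formJ E * a.val) * b.val := by
          simp only [Matrix.mul_assoc]
      _ = _ := by rw [ha, hb]
  inv_mem' {a} ha := by
    simp only [Set.mem_ofPred_eq] at *
    have h1 : a.val * (a⁻¹).val = 1 := by simp
    have h2 : ((a⁻¹).val.map σ).transpose * (a.val.map σ).transpose = 1 := by
      rw [← Matrix.transpose_mul, ← Matrix.map_mul, h1]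
      simp [Matrix.map_one]
    calc ((a⁻¹).val.map σ).transpose * formJ E * (a⁻¹).val
        = ((a⁻¹).val.map σ).transpose *
            ((a.val.map σ).transpose * formJ E * a.val) * (a⁻¹).val := by rw [ha]
      _ = (((a⁻¹).val.map σ).transpose * (a.val.map σ).transpose) * formJ E *
            (a.val * (a⁻¹).val) := by simp only [Matrix.mul_assoc]
      _ = formJ E := by rw [h1, h2, one_mul, mul_one]

/-- The `(i, j)` entry of an element of `G`. -/
abbrev entry {σ : E ≃ₐ[F] E} (g : unitaryG σ) (i j : Fin 3) : E := g.val.val i j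

/-- The Borel subgroup `B` of upper triangular elements of `G`. -/
def borelB (σ : E ≃ₐ[F] E) : Subgroup (unitaryG σ) where
  carrier := {g | ∀ i j : Fin 3, j < i → entry g i j = 0}
  one_mem' := by
    intro i j h
    simp [entry, h.ne']
  mul_mem' {a b} ha hb :=
    fun i j h => Matrix.BlockTriangular.mul (b := id) (fun i j h => ha i j h)
      (fun i j h => hb i j h) h
  inv_mem' {a} ha := by
    intro i j h
    have := Matrix.blockTriangular_inv_of_blockTriangular (M := a.val.val) (b := id)
      (fun i j h => ha i j h) h
    simpa [entry, Matrix.coe_units_inv] using this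

lemma diag_mul {σ : E ≃ₐ[F] E} (a b : borelB σ) (i : Fin 3) :
    entry (a * b).val i i = entry a.val i i * entry b.val i i := by
  have ha := fun i j h => a.2 i j h
  have hb := fun i j h => b.2 i j h
  simp only [entry] at ha hb
  change (a.val.val.val * b.val.val.val) i i = _
  fin_cases i <;> simp [Matrix.mul_apply, Fin.sum_univ_three, entry, ha, hb]

/-- The `i`-th diagonal entry, as a homomorphism from `B` to `Eˣ`. -/
def diagEntry (σ : E ≃ₐ[F] E) (i : Fin 3) : borelB σ →* Eˣ :=
  MonoidHom.toHomUnits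
    { toFun := fun b => entry b.val i i
      map_one' := by simp [entry]
      map_mul' := fun a b => diag_mul a b i }

lemma diagEntry_one_mem {σ : E ≃ₐ[F] E} (b : borelB σ) : diagEntry σ 1 b ∈ normOne σ := by
  have hb := fun i j h => b.2 i j h
  have h := congrFun (congrFun b.val.2 1) 1
  simp only [entry] at hb
  simp [Matrix.mul_apply, Fin.sum_univ_three, formJ, hb] at h
  change entry b.val 1 1 * σ (entry b.val 1 1) = 1
  rw [mul_comm]
  exact h

/-- The middle diagonal entry, as a homomorphism from `B` to `E¹`. -/
def midEntry (σ : E ≃ₐ[F] E) : borelB σ →* normOne σ :=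
  (diagEntry σ 1).codRestrict (normOne σ) diagEntry_one_mem

/-- The scalar matrices `ι : E¹ → Z` from the norm-one group to the center `Z` of `G`. -/
def iota (σ : E ≃ₐ[F] E) : normOne σ →* Subgroup.center (unitaryG σ) where
  toFun a := ⟨⟨Matrix.GeneralLinearGroup.scalar (Fin 3) a.val, by
      have h : (a.val : E) * σ a.val = 1 := a.2
      change ((Matrix.scalar (Fin 3) (a.val : E)).map σ).transpose * formJ E *
        Matrix.scalar (Fin 3) (a.val : E) = formJ E
      ext i j
      fin_cases i <;> fin_cases j <;>
        simp [Matrix.mul_apply, formJ, Matrix.diagonal_apply, mul_comm, h]⟩, by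
      rw [Subgroup.mem_center_iff]
      intro g
      apply Subtype.ext
      apply Units.ext
      change g.val.val * Matrix.scalar (Fin 3) (a.val : E) =
        Matrix.scalar (Fin 3) (a.val : E) * g.val.val
      exact ((Matrix.scalar_commute (a.val : E) (fun r => mul_comm _ r) g.val.val).eq).symm⟩
  map_one' := by
    apply Subtype.ext; apply Subtype.ext
    exact map_one (Matrix.GeneralLinearGroup.scalar (Fin 3))
  map_mul' a b := by
    apply Subtype.ext; apply Subtype.ext
    exact map_mul (Matrix.GeneralLinearGroup.scalar (Fin 3)) a.val b.val

end Group

/-! ## Level subgroups, representations and conductors -/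

section Conductors

variable {F E : Type*} [Field F] [Field E] [Algebra F E] [ValuativeRel E] [TopologicalSpace E]
  [IsNonarchimedeanLocalField E]

/-- The set `E¹_n`, which is `E¹` for `n = 0` and `E¹ ∩ (1 + 𝔭_E ^ n)` for `n ≥ 1`. -/
def normOneLevel (σ : E ≃ₐ[F] E) (n : ℕ) : Set (normOne σ) :=
  {b | n = 0 ∨ (b.val : E) - 1 ∈ primePow E n}

/-- The character `μ₂` of `E¹` is trivial on `E¹_n`. -/
def TrivialAtLevel₁ {σ : E ≃ₐ[F] E} (μ₂ : normOne σ →ₜ* ℂˣ) (n : ℕ) : Prop :=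
  ∀ b ∈ normOneLevel σ n, μ₂ b = 1

/-- The conductor `c(μ₂)` of a character of `E¹`. -/
def conductor₁ {σ : E ≃ₐ[F] E} (μ₂ : normOne σ →ₜ* ℂˣ) : ℕ := sInf {n | TrivialAtLevel₁ μ₂ n}

/-- The character `ω` of the center `Z` of `G` is trivial on `Z_n = ι(E¹_n)`. -/
def TrivialAtLevelZ {σ : E ≃ₐ[F] E} (ω : Subgroup.center (unitaryG σ) →* ℂˣ) (n : ℕ) : Prop :=
  ∀ z ∈ iota σ '' normOneLevel σ n, ω z = 1

/-- The conductor of a character of the center of `G`. It is `n_π` for the central character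
of `π`. -/
def conductorZ {σ : E ≃ₐ[F] E} (ω : Subgroup.center (unitaryG σ) →* ℂˣ) : ℕ :=
  sInf {n | TrivialAtLevelZ ω n}

/-- The compact open subgroup `K_n` of `G` (as a set), given by the shape
`(𝔬, 𝔬, 𝔭⁻ⁿ; 𝔭ⁿ, 1 + 𝔭ⁿ, 𝔬; 𝔭ⁿ, 𝔭ⁿ, 𝔬)`. -/
def levelK (σ : E ≃ₐ[F] E) (n : ℕ) : Set (unitaryG σ) :=
  {g | entry g 0 0 ∈ primePow E 0 ∧ entry g 0 1 ∈ primePow E 0 ∧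
       entry g 0 2 ∈ primePow E (-(n : ℤ)) ∧
       entry g 1 0 ∈ primePow E n ∧ entry g 1 1 - 1 ∈ primePow E n ∧
       entry g 1 2 ∈ primePow E 0 ∧
       entry g 2 0 ∈ primePow E n ∧ entry g 2 1 ∈ primePow E n ∧
       entry g 2 2 ∈ primePow E 0}

/-- The space `V(n)` of `K_n`-fixed vectors of a representation `(π, V)` of `G`. -/
def fixedVectors {σ : E ≃ₐ[F] E} {V : Type*} [AddCommGroup V] [Module ℂ V]
    (π : Representation ℂ (unitaryG σ) V) (n : ℕ) : Submodule ℂ V where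
  carrier := {v | ∀ k ∈ levelK σ n, π k v = v}
  zero_mem' := by simp
  add_mem' {v w} hv hw := by
    intro k hk
    rw [map_add, hv k hk, hw k hk]
  smul_mem' c v hv := by
    intro k hk
    rw [map_smul, hv k hk]

/-- The representation `π` admits a newform. -/
def AdmitsNewform {σ : E ≃ₐ[F] E} {V : Type*} [AddCommGroup V] [Module ℂ V]
    (π : Representation ℂ (unitaryG σ) V) : Prop :=
  ∃ n : ℕ, fixedVectors π n ≠ ⊥

/-- The conductor `N_π` of a representation `π` that admits a newform. -/
def conductorRep {σ : E ≃ₐ[F] E} {V : Type*} [AddCommGroup V] [Module ℂ V]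
    (π : Representation ℂ (unitaryG σ) V) : ℕ :=
  sInf {n | fixedVectors π n ≠ ⊥}

/-- The center of `G` acts on `π` through the character `ω`. -/
def IsCentralCharacter {σ : E ≃ₐ[F] E} {V : Type*} [AddCommGroup V] [Module ℂ V]
    (π : Representation ℂ (unitaryG σ) V) (ω : Subgroup.center (unitaryG σ) →* ℂˣ) : Prop :=
  ∀ (z : Subgroup.center (unitaryG σ)) (v : V), π z.val v = (ω z : ℂ) • v

/-- The quasi-character `μ₁ ⊗ μ₂` of `B`, with value `μ₁(a) μ₂(b)` at an element with diagonal
`(a, b, ā⁻¹)`; it is trivial on the unipotent radical. -/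
def tensorChar {σ : E ≃ₐ[F] E} (μ₁ : Eˣ →ₜ* ℂˣ) (μ₂ : normOne σ →ₜ* ℂˣ) : borelB σ →* ℂˣ :=
  μ₁.toMonoidHom.comp (diagEntry σ 0) * μ₂.toMonoidHom.comp (midEntry σ)

/-- The modulus character of `B`, with value `|a|_E ^ 2` at an element with diagonal
`(a, b, ā⁻¹)`. -/
def modulusB {σ : E ≃ₐ[F] E} (b : borelB σ) : ℝ := normAbs E (diagEntry σ 0 b : E) ^ 2

/-- The space of the normalized parabolic induction of a quasi-character `μ` of `B`: locally
constant functions `f : G → ℂ` with `f(bg) = δ_B(b)^{1/2} μ(b) f(g)`. -/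
def inducedSpace {σ : E ≃ₐ[F] E} (μ : borelB σ →* ℂˣ) : Submodule ℂ (unitaryG σ → ℂ) where
  carrier := {f | IsLocallyConstant f ∧ ∀ (b : borelB σ) (g : unitaryG σ),
    f (b.val * g) = (Real.sqrt (modulusB b) : ℂ) * (μ b : ℂ) * f g}
  zero_mem' := ⟨IsLocallyConstant.const 0, by simp⟩
  add_mem' {f g} hf hg := ⟨hf.1.add hg.1, fun b x => by
    simp only [Pi.add_apply, hf.2 b x, hg.2 b x]; ring⟩
  smul_mem' c f hf := ⟨hf.1.comp (fun y => c • y), fun b x => by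
    simp only [Pi.smul_apply, smul_eq_mul, hf.2 b x]; ring⟩

/-- The normalized parabolic induction of `μ` from `B` to `G`: the group acts by right
translation, `(π(g) f)(x) = f(x g)`. -/
def parabolicInd {σ : E ≃ₐ[F] E} (μ : borelB σ →* ℂˣ) :
    Representation ℂ (unitaryG σ) (inducedSpace μ) where
  toFun g :=
    { toFun := fun f => ⟨fun x => f.val (x * g),
        f.2.1.comp_continuous (continuous_mul_const g), fun b x => by
          change f.val (b.val * x * g) = _
          rw [mul_assoc]
          exact f.2.2 b (x * g)⟩
      map_add' := fun _ _ => rfl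
      map_smul' := fun _ _ => rfl }
  map_one' := by
    ext f x
    simp
  map_mul' g h := by
    ext f x
    simp [mul_assoc]

end Conductors

end

end UnramifiedU3

open UnramifiedU3

namespace UnramifiedU3

set_option linter.unusedSectionVars false

/-! ### The valuation of a local field and the absence of small subgroups in `ℂˣ` -/

section Valuation

variable {E : Type*} [Field E] [ValuativeRel E] [TopologicalSpace E]
  [IsNonarchimedeanLocalField E]

/-! A coset `B g` is determined by the last row `(p, q, r)` of `g` up to a scalar, so a fixed vector
can be studied by asking which entry of that row dominates relative to `K_n`. If `p` or `r`
dominates, then `g ∈ B K_n` (`exists_mul_inv_mem_borelB_upper`, `exists_mul_inv_mem_borelB_lower`),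
and a fixed vector `f` with `f(g) ≠ 0` has `f(1) ≠ 0`.

If `q` dominates, isotropy of the row forces `n ≥ 2`, and for every `λ ∈ E¹_{n-1}` some product of
`λ` with a central unipotent of `B` is conjugated by `g` into `K_n`
(`exists_scalarUnipotentElt_conj_mem_levelK`). Then `f(g) ≠ 0` makes the central character, which is
`μ₁μ₂` on scalars, trivial on `E¹_{n-1}`.

Suppose now `N_π = n_π = n` and `f ≠ 0` has level `n`. The second case contradicts the minimality of
`n_π`, so `f(1) ≠ 0`. As `K_n` contains `diag(a, 1, ā⁻¹)` for every unit `a`, this gives `μ₁(a) =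
1`. Conversely, if `μ₁` is unramified, the function supported on `B K_n` with `n = c(μ₂)` is well
defined, whence `N_π ≤ c(μ₂)`. The central character is then `μ₂`, so `n_π = c(μ₂)`, and `n_π ≤ N_π`
always holds because `ι(E¹_n) ⊆ K_n`. -/

open IsNonarchimedeanLocalField in
lemma val_le_val_iff (x y : E) : val E x ≤ val E y ↔ valuation E x ≤ valuation E y :=
  (valueGroupWithZeroIsoInt E).map_le_map_iff'

@[simp] lemma val_zero : val E (0 : E) = 0 := by simp [val]

@[simp] lemma val_one : val E (1 : E) = 1 := by simp [val]

@[simp] lemma val_mul (x y : E) : val E (x * y) = val E x * val E y := by simp [val]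

@[simp] lemma val_neg (x : E) : val E (-x) = val E x := by simp [val]

@[simp] lemma val_eq_zero (x : E) : val E x = 0 ↔ x = 0 := by simp [val]

@[simp] lemma val_inv (x : E) : val E x⁻¹ = (val E x)⁻¹ := by simp [val]

@[simp] lemma val_div (x y : E) : val E (x / y) = val E x / val E y := by simp [val]

@[simp] lemma val_pow (x : E) (n : ℕ) : val E (x ^ n) = val E x ^ n := by simp [val]

lemma val_add_le (x y : E) : val E (x + y) ≤ max (val E x) (val E y) := by
  rcases le_total (valuation E x) (valuation E y) with h | h
  · have := (val_le_val_iff (x + y) y).2 (((valuation E).map_add x y).trans (by simp [h]))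
    exact this.trans (le_max_right _ _)
  · have := (val_le_val_iff (x + y) x).2 (((valuation E).map_add x y).trans (by simp [h]))
    exact this.trans (le_max_left _ _)

lemma val_surjective : Function.Surjective (val E) :=
  (IsNonarchimedeanLocalField.valueGroupWithZeroIsoInt E).surjective.comp
    ValuativeRel.valuation_surjective

lemma exists_val_eq_exp (n : ℤ) : ∃ x : E, x ≠ 0 ∧ val E x = WithZero.exp n := by
  obtain ⟨x, hx⟩ := val_surjective (E := E) (WithZero.exp n)
  refine ⟨x, ?_, hx⟩
  rintro rfl
  exact WithZero.exp_ne_zero (hx.symm.trans val_zero)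

lemma exists_exp_eq_val {x : E} (hx : x ≠ 0) : ∃ n : ℤ, val E x = WithZero.exp n := by
  have h : val E x ≠ 0 := by simpa using hx
  exact ⟨WithZero.log (val E x), (WithZero.exp_log h).symm⟩

lemma normAbs_eq_one {x : E} (hx : val E x = 1) : normAbs E x = 1 := by
  simp [normAbs, hx]

/-! ### Powers of the prime ideal -/

lemma mem_primePow {n : ℤ} {x : E} : x ∈ primePow E n ↔ val E x ≤ WithZero.exp (-n) := Iff.rfl

lemma mem_primePow_zero {x : E} : x ∈ primePow E 0 ↔ val E x ≤ 1 := by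
  simp [primePow]

lemma zero_mem_primePow (n : ℤ) : (0 : E) ∈ primePow E n := by simp [primePow]

lemma one_mem_primePow : (1 : E) ∈ primePow E 0 := by simp [primePow]

lemma primePow_anti {m n : ℤ} (h : m ≤ n) {x : E} (hx : x ∈ primePow E n) : x ∈ primePow E m :=
  le_trans (mem_primePow.1 hx) (WithZero.exp_le_exp.2 (neg_le_neg h))

lemma add_mem_primePow {n : ℤ} {x y : E} (hx : x ∈ primePow E n) (hy : y ∈ primePow E n) :
    x + y ∈ primePow E n :=
  (val_add_le x y).trans (max_le hx hy)

lemma neg_mem_primePow {n : ℤ} {x : E} (hx : x ∈ primePow E n) : -x ∈ primePow E n := by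
  simpa [primePow] using hx

lemma sub_mem_primePow {n : ℤ} {x y : E} (hx : x ∈ primePow E n) (hy : y ∈ primePow E n) :
    x - y ∈ primePow E n := by
  rw [sub_eq_add_neg]
  exact add_mem_primePow hx (neg_mem_primePow hy)

lemma mul_mem_primePow {m n k : ℤ} {x y : E} (hx : x ∈ primePow E m) (hy : y ∈ primePow E n)
    (h : k ≤ m + n) : x * y ∈ primePow E k := by
  refine primePow_anti h ?_
  rw [mem_primePow, val_mul, neg_add, WithZero.exp_add]
  exact mul_le_mul' hx hy

lemma val_eq_one_of_sub_mem {n : ℤ} (hn : 1 ≤ n) {x : E} (hx : x - 1 ∈ primePow E n) :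
    val E x = 1 := by
  have h1 : val E (x - 1) < 1 := by
    refine lt_of_le_of_lt hx ?_
    rw [← WithZero.exp_zero, WithZero.exp_lt_exp]
    omega
  refine le_antisymm ?_ ?_
  · have := val_add_le (x - 1) 1
    simpa [h1.le] using this
  · by_contra! h
    have := val_add_le x (-(x - 1))
    rw [val_neg, show x + -(x - 1) = 1 by ring, val_one] at this
    exact absurd this (not_le.2 (max_lt h h1))

lemma isOpen_primePow (n : ℤ) : IsOpen (primePow E n) := by
  obtain ⟨x, hx0, hx⟩ := exists_val_eq_exp (E := E) (-n)
  have : primePow E n = {y | valuation E y ≤ valuation E x} := by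
    ext y
    rw [mem_primePow, ← hx, val_le_val_iff]
    rfl
  simp_rw [this, ← (valuation E).restrict_le_iff]
  exact Valuation.isOpen_closedBall (by simpa using hx0)

lemma exists_primePow_subset {U : Set E} (hU : U ∈ nhds (0 : E)) :
    ∃ n : ℕ, 1 ≤ n ∧ primePow E n ⊆ U := by
  obtain ⟨r, hr, hrU⟩ := (IsValuativeTopology.hasBasis_nhds_zero' E).mem_iff.mp hU
  obtain ⟨x, rfl⟩ := ValuativeRel.valuation_surjective r
  have hx : x ≠ 0 := by simpa using hr
  obtain ⟨m, hm⟩ := exists_exp_eq_val hx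
  refine ⟨(1 - m).toNat + 1, by omega, fun y hy => hrU ?_⟩
  change valuation E y < valuation E x
  rw [← not_le, ← val_le_val_iff, not_le, hm]
  refine lt_of_le_of_lt hy ?_
  rw [WithZero.exp_lt_exp]
  omega

/-- A quasi-character of a subgroup of `Eˣ` is trivial on the elements close enough to `1`. -/
lemma exists_trivial_of_continuous {H : Type*} [Group H] [TopologicalSpace H]
    (i : H →* Eˣ) (hi : Topology.IsInducing i) (μ : H →ₜ* ℂˣ) :
    ∃ n : ℕ, 1 ≤ n ∧ ∀ a : H, (i a : E) - 1 ∈ primePow E n → μ a = 1 := by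
  have hU : {a : H | ‖(μ a : ℂ) - 1‖ < 1 / 2} ∈ nhds (1 : H) := by
    have hc : Continuous fun a : H => ‖(μ a : ℂ) - 1‖ :=
      ((Units.continuous_val.comp μ.continuous_toFun).sub continuous_const).norm
    exact hc.continuousAt.preimage_mem_nhds
      (isOpen_Iio.mem_nhds (by simp))
  have hemb : Topology.IsInducing fun a : H => (i a : E) - 1 :=
    ((Homeomorph.subRight (1 : E)).isInducing.comp Units.isEmbedding_val₀.isInducing).comp hi
  rw [hemb.nhds_eq_comap] at hU
  obtain ⟨V, hV, hVU⟩ := hU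
  rw [map_one, Units.val_one, sub_self] at hV
  obtain ⟨n, hn, hnV⟩ := exists_primePow_subset hV
  refine ⟨n, hn, fun a ha => ?_⟩
  -- The ball `1 + 𝔭ⁿ` is stable under powers, so all powers of `μ a` stay within `1/2` of `1`.
  have hpow : ∀ k : ℕ, ((i a : E)) ^ k - 1 ∈ primePow E n := by
    have h1 : (i a : E) ∈ primePow E 0 :=
      mem_primePow_zero.2 (val_eq_one_of_sub_mem (by exact_mod_cast hn) ha).le
    intro k
    induction k with
    | zero => simpa using zero_mem_primePow (E := E) n
    | succ k ih =>
      rw [show (i a : E) ^ (k + 1) - 1 = ((i a : E) ^ k - 1) * (i a : E) + ((i a : E) - 1) by ring]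
      exact add_mem_primePow (mul_mem_primePow ih h1 (by simp)) ha
  have hlt : ∀ k : ℕ, ‖(μ a : ℂ) ^ k - 1‖ < 1 / 2 := by
    intro k
    have := hVU (show a ^ k ∈ _ from hnV (by simpa using hpow k))
    simpa using this
  set z : ℂ := (μ a : ℂ)
  -- Near `1` we have `|w + 1| ≥ 3/2`, so each squaring multiplies the distance to `1` by at least
  -- `3/2`; boundedness then forces `z = 1`.
  have hgrow : ∀ j : ℕ, (3 / 2 : ℝ) ^ j * ‖z - 1‖ ≤ ‖z ^ (2 ^ j) - 1‖ := by
    intro j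
    induction j with
    | zero => simp
    | succ j ih =>
      have h2 : z ^ (2 ^ (j + 1)) - 1 = (z ^ (2 ^ j) - 1) * (z ^ (2 ^ j) + 1) := by ring
      have h3 : (3 / 2 : ℝ) ≤ ‖z ^ (2 ^ j) + 1‖ := by
        have h4 := norm_sub_le (z ^ (2 ^ j) + 1) (z ^ (2 ^ j) - 1)
        have h5 : z ^ (2 ^ j) + 1 - (z ^ (2 ^ j) - 1) = 2 := by ring
        rw [h5] at h4
        have h6 : ‖(2 : ℂ)‖ = 2 := by simp
        linarith [hlt (2 ^ j)]
      rw [h2, norm_mul, pow_succ, mul_assoc, mul_comm (3 / 2 : ℝ), ← mul_assoc]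
      exact mul_le_mul ih h3 (by norm_num) (norm_nonneg _)
  have hz : z - 1 = 0 := by
    by_contra hz
    have hpos : 0 < ‖z - 1‖ := norm_pos_iff.2 hz
    obtain ⟨j, hj⟩ := pow_unbounded_of_one_lt (1 / ‖z - 1‖) (by norm_num : (1 : ℝ) < 3 / 2)
    rw [div_lt_iff₀ hpos] at hj
    linarith [hgrow j, hlt (2 ^ j)]
  exact Units.ext (sub_eq_zero.1 hz)

end Valuation

/-! ### Galois conjugation and the valuation of `E` -/

section QuadraticExtension

variable {F E : Type*} [Field F] [ValuativeRel F] [TopologicalSpace F]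
  [IsNonarchimedeanLocalField F] [Field E] [ValuativeRel E] [TopologicalSpace E]
  [IsNonarchimedeanLocalField E] [Algebra F E] [ValuativeExtension F E]

lemma val_algebraMap_le_iff (x y : F) :
    val E (algebraMap F E x) ≤ val E (algebraMap F E y) ↔ valuation F x ≤ valuation F y := by
  rw [val_le_val_iff, ← Valuation.Compatible.vle_iff_le, ← Valuation.Compatible.vle_iff_le,
    ValuativeExtension.vle_iff_vle]

lemma val_algebraMap_eq_one {x : F} (h : valuation F x = 1) :
    val E (algebraMap F E x) = 1 := by
  have h1 := val_algebraMap_le_iff (E := E) x 1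
  have h2 := val_algebraMap_le_iff (E := E) 1 x
  simp only [map_one, val_one] at h1 h2
  exact le_antisymm (h1.2 h.le) (h2.2 h.ge)

/-- The compact ring of integers contains no square roots of a non-square, so that `w² - ε` is
bounded below there. -/
lemma exists_le_valuation_sq_sub {ε : F} (hε' : ¬ IsSquare ε) :
    ∃ δ : F, δ ≠ 0 ∧ ∀ w : F, valuation F w ≤ 1 → valuation F δ ≤ valuation F (w ^ 2 - ε) := by
  have : T2Space F := by
    let := IsTopologicalAddGroup.rightUniformSpace F
    have := isUniformAddGroup_of_addCommGroup (G := F)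
    infer_instance
  have hK := (IsNonarchimedeanLocalField.isCompact_closedBall F 1).image
    (f := fun w : F => w ^ 2 - ε) (by fun_prop)
  have h0 : (0 : F) ∉ (fun w : F => w ^ 2 - ε) '' {x | valuation F x ≤ 1} := by
    rintro ⟨w, -, hw⟩
    exact hε' ⟨w, by rw [← pow_two]; exact (sub_eq_zero.1 hw).symm⟩
  obtain ⟨r, hr, hrU⟩ := (IsValuativeTopology.hasBasis_nhds_zero' F).mem_iff.mp
    (hK.isClosed.isOpen_compl.mem_nhds h0)
  obtain ⟨δ, rfl⟩ := ValuativeRel.valuation_surjective r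
  refine ⟨δ, by simpa using hr, fun w hw => ?_⟩
  by_contra! h
  exact hrU h ⟨w, hw, rfl⟩

/-- The `F`-span of `1` and `s` is closed under multiplication because `s² ∈ F`. -/
lemma exists_eq_add_mul {ε : F} {s : E} (hs : s ^ 2 = algebraMap F E ε)
    (hE : IntermediateField.adjoin F {s} = ⊤) (x : E) :
    ∃ u v : F, x = algebraMap F E u + algebraMap F E v * s := by
  have hint : IsIntegral F s := by
    refine ⟨Polynomial.X ^ 2 - Polynomial.C ε, Polynomial.monic_X_pow_sub_C ε two_ne_zero, ?_⟩
    simp [hs]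
  have hx : x ∈ Algebra.adjoin F {s} := by
    have h1 : x ∈ IntermediateField.adjoin F {s} := hE ▸ IntermediateField.mem_top
    rwa [← IntermediateField.mem_toSubalgebra,
      IntermediateField.adjoin_simple_toSubalgebra_of_isAlgebraic hint.isAlgebraic] at h1
  induction hx using Algebra.adjoin_induction with
  | mem y hy => exact ⟨0, 1, by simpa using hy⟩
  | algebraMap r => exact ⟨r, 0, by simp⟩
  | add x y _ _ hx hy =>
    obtain ⟨u, v, rfl⟩ := hx
    obtain ⟨u', v', rfl⟩ := hy
    exact ⟨u + u', v + v', by simp only [map_add]; ring⟩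
  | mul x y _ _ hx hy =>
    obtain ⟨u, v, rfl⟩ := hx
    obtain ⟨u', v', rfl⟩ := hy
    refine ⟨u * u' + v * v' * ε, u * v' + v * u', ?_⟩
    simp only [map_add, map_mul]
    linear_combination (algebraMap F E v * algebraMap F E v') * hs

/-- The only square roots of `s²` are `±s`, and an automorphism fixing the generator `s` is the
identity. -/
lemma conj_sqrt {ε : F} {s : E} (hs : s ^ 2 = algebraMap F E ε)
    (hE : IntermediateField.adjoin F {s} = ⊤) {σ : E ≃ₐ[F] E} (hσ : σ ≠ AlgEquiv.refl) :
    σ s = -s := by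
  have h : (σ s) ^ 2 = s ^ 2 := by rw [← map_pow, hs, AlgEquiv.commutes]
  rcases sq_eq_sq_iff_eq_or_eq_neg.1 h with h | h
  · refine absurd (AlgEquiv.ext fun x => ?_) hσ
    obtain ⟨u, v, rfl⟩ := exists_eq_add_mul hs hE x
    simp [h]
  · exact h

lemma conj_conj {ε : F} {s : E} (hs : s ^ 2 = algebraMap F E ε)
    (hE : IntermediateField.adjoin F {s} = ⊤) {σ : E ≃ₐ[F] E} (hσ : σ ≠ AlgEquiv.refl) (x : E) :
    σ (σ x) = x := by
  obtain ⟨u, v, rfl⟩ := exists_eq_add_mul hs hE x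
  simp [conj_sqrt hs hE hσ]

/-- The valuation of `E` is invariant under the Galois group of `E / F`. -/
lemma val_conj {ε : F} (hε : valuation F ε = 1) (hε' : ¬ IsSquare ε) {s : E}
    (hs : s ^ 2 = algebraMap F E ε) (hE : IntermediateField.adjoin F {s} = ⊤)
    {σ : E ≃ₐ[F] E} (hσ : σ ≠ AlgEquiv.refl) (x : E) : val E (σ x) = val E x := by
  obtain ⟨δ, hδ0, hδ⟩ := exists_le_valuation_sq_sub hε'
  have hvs : val E s = 1 := by
    have h : val E s ^ 2 = 1 := by rw [← val_pow, hs, val_algebraMap_eq_one hε]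
    exact (pow_eq_one_iff_of_nonneg zero_le two_ne_zero).1 h
  set D := val E (algebraMap F E δ)
  have hD0 : D ≠ 0 := by simpa [D] using hδ0
  have hD : ∀ w : F, val E (algebraMap F E w) ≤ 1 →
      D ≤ val E (algebraMap F E w ^ 2 - s ^ 2) := by
    intro w hw
    rw [hs, ← map_pow, ← map_sub, val_algebraMap_le_iff]
    refine hδ w ?_
    have := val_algebraMap_le_iff (E := E) w 1
    simp only [map_one, val_one] at this
    exact this.1 hw
  have hD1 : D ≤ 1 := by
    have := hD 0 (by simp)
    simpa [hvs] using this
  -- the norm form is bounded below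
  have hnorm : ∀ u v : F, D * max (val E (algebraMap F E u)) (val E (algebraMap F E v)) ^ 2 ≤
      val E (algebraMap F E u ^ 2 - algebraMap F E v ^ 2 * s ^ 2) := by
    intro u v
    rcases le_or_gt (val E (algebraMap F E u)) (val E (algebraMap F E v)) with h | h
    · rw [max_eq_right h]
      rcases eq_or_ne v 0 with rfl | hv
      · simp
      have hv' : algebraMap F E v ≠ 0 := by simpa using hv
      have h1 := hD (u / v) (by
        rw [map_div₀, val_div]
        exact div_le_one_of_le₀ h zero_le)
      calc D * val E (algebraMap F E v) ^ 2
          ≤ val E (algebraMap F E (u / v) ^ 2 - s ^ 2) * val E (algebraMap F E v) ^ 2 := by gcongr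
        _ = _ := by
          rw [← val_pow, ← val_mul]
          congr 1
          rw [map_div₀]
          field_simp
    · rw [max_eq_left h.le]
      have h2 : val E (algebraMap F E v ^ 2 * s ^ 2) < val E (algebraMap F E u ^ 2) := by
        simp only [val_mul, val_pow, hvs, one_pow, mul_one]
        exact pow_lt_pow_left₀ h zero_le two_ne_zero
      have h3 := val_add_le (algebraMap F E u ^ 2 - algebraMap F E v ^ 2 * s ^ 2)
        (algebraMap F E v ^ 2 * s ^ 2)
      rw [sub_add_cancel] at h3
      have h4 := (le_max_iff.1 h3).resolve_right (not_le.2 h2)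
      refine le_trans ?_ h4
      rw [val_pow]
      exact mul_le_of_le_one_left zero_le hD1
  -- For `y = u + vs` the product `y · σ y` is the norm form `u² - v²s²`, so its lower bound
  -- compares `σ y` with `y` up to the constant `D`.
  have hlow : ∀ y : E, D * val E y ≤ val E (σ y) := by
    intro y
    rcases eq_or_ne y 0 with rfl | hy
    · simp
    obtain ⟨u, v, huv⟩ := exists_eq_add_mul hs hE y
    have hle : val E y ≤ max (val E (algebraMap F E u)) (val E (algebraMap F E v)) := by
      rw [huv]
      refine (val_add_le _ _).trans (by simp [hvs])
    have h1 : D * val E y ^ 2 ≤ val E (σ y) * val E y := by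
      refine le_trans ?_ ((hnorm u v).trans (le_of_eq ?_))
      · gcongr
      · rw [← val_mul]
        congr 1
        rw [huv]
        simp only [map_add, map_mul, AlgEquiv.commutes, conj_sqrt hs hE hσ]
        ring
    rw [pow_two, ← mul_assoc] at h1
    exact le_of_mul_le_mul_right h1 (by simpa [zero_lt_iff] using hy)
  have hge : ∀ y : E, val E y ≤ val E (σ y) := by
    intro y
    by_contra! h
    have hy : y ≠ 0 := by rintro rfl; simp at h
    have hσy : σ y ≠ 0 := by simpa using hy
    obtain ⟨a, ha⟩ := exists_exp_eq_val hy
    obtain ⟨b, hb⟩ := exists_exp_eq_val hσy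
    obtain ⟨d, hd⟩ := exists_exp_eq_val (E := E) (x := algebraMap F E δ) (by simpa using hδ0)
    -- Passing to powers removes the constant: if `σ y` were strictly smaller than `y`, the
    -- exponents would differ by at least `|d| + 1` here, more than `D = exp d` allows.
    have h1 := hlow (y ^ (d.natAbs + 1))
    rw [map_pow, val_pow, val_pow, ha, hb, show D = _ from hd, ← WithZero.exp_nsmul,
      ← WithZero.exp_nsmul, ← WithZero.exp_add, WithZero.exp_le_exp] at h1
    rw [ha, hb, WithZero.exp_lt_exp] at h
    simp only [nsmul_eq_mul, Nat.cast_add, Nat.cast_one, Int.natCast_natAbs] at h1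
    have h2 : -|d| ≤ d := neg_abs_le d
    nlinarith [abs_nonneg d]
  refine le_antisymm ?_ (hge x)
  have := hge (σ x)
  rwa [conj_conj hs hE hσ] at this

/-- A non-unit `2` would vanish in the residue field of `F`. Odd residual characteristic enters only
here; it makes division by `2` harmless for integrality. -/
lemma val_two (hF : ringChar 𝓀[F] ≠ 2) : val E (2 : E) = 1 := by
  have h : valuation F (2 : F) = 1 := by
    by_contra h
    have h2 : (2 : 𝒪[F]) ∈ IsLocalRing.maximalIdeal 𝒪[F] := by
      rw [IsLocalRing.mem_maximalIdeal, mem_nonunits_iff]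
      intro hu
      exact h ((Valuation.integer.integers (valuation F)).one_of_isUnit hu)
    have h3 : (2 : 𝓀[F]) = 0 := by
      rw [← IsLocalRing.residue_eq_zero_iff, map_ofNat] at h2
      exact h2
    have h4 : ringChar 𝓀[F] ∣ 2 := (ringChar.spec 𝓀[F] 2).1 (by simpa using h3)
    rcases (Nat.dvd_prime Nat.prime_two).1 h4 with h5 | h5
    · have := ringChar.spec 𝓀[F] 1
      simp [h5] at this
    · exact hF h5
  rw [← map_ofNat (algebraMap F E) 2]
  exact val_algebraMap_eq_one h

end QuadraticExtension

/-! ### Matrix entries, explicit elements and the center of `G` -/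

section UnitaryGroup

variable {F E : Type*} [Field F] [Field E] [Algebra F E] {σ : E ≃ₐ[F] E}

lemma formJ_mul_formJ : formJ E * formJ E = 1 := by
  ext i j
  fin_cases i <;> fin_cases j <;> simp [formJ, Matrix.mul_apply, Fin.sum_univ_three]

lemma form_apply (M : Matrix (Fin 3) (Fin 3) E) (i j : Fin 3) :
    ((M.map σ).transpose * formJ E * M) i j =
      σ (M 0 i) * M 2 j + σ (M 1 i) * M 1 j + σ (M 2 i) * M 0 j := by
  simp [formJ, Matrix.mul_apply, Fin.sum_univ_three]
  ring

/-- The element of `G` with a given matrix. -/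
def ofMatrix (M : Matrix (Fin 3) (Fin 3) E)
    (h : ∀ i j, σ (M 0 i) * M 2 j + σ (M 1 i) * M 1 j + σ (M 2 i) * M 0 j = formJ E i j) :
    unitaryG σ :=
  have h' : (M.map σ).transpose * formJ E * M = formJ E := by
    ext i j
    rw [form_apply, h]
  have h1 : (formJ E * (M.map σ).transpose * formJ E) * M = 1 := by
    rw [Matrix.mul_assoc, Matrix.mul_assoc, ← Matrix.mul_assoc _ _ M, h', formJ_mul_formJ]
  ⟨⟨M, formJ E * (M.map σ).transpose * formJ E, mul_eq_one_comm.1 h1, h1⟩, h'⟩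

@[simp] lemma entry_ofMatrix (M : Matrix (Fin 3) (Fin 3) E)
    (h : ∀ i j, σ (M 0 i) * M 2 j + σ (M 1 i) * M 1 j + σ (M 2 i) * M 0 j = formJ E i j)
    (i j : Fin 3) : entry (ofMatrix M h) i j = M i j := rfl

lemma entry_ext {g h : unitaryG σ} (H : ∀ i j, entry g i j = entry h i j) : g = h :=
  Subtype.ext (Units.ext (Matrix.ext H))

lemma entry_form (g : unitaryG σ) (i j : Fin 3) :
    σ (entry g 0 i) * entry g 2 j + σ (entry g 1 i) * entry g 1 j + σ (entry g 2 i) * entry g 0 j =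
      formJ E i j := by
  rw [← form_apply, show (g.val.val.map σ).transpose * formJ E * g.val.val = formJ E from g.2]

lemma entry_mul (g h : unitaryG σ) (i j : Fin 3) :
    entry (g * h) i j =
      entry g i 0 * entry h 0 j + entry g i 1 * entry h 1 j + entry g i 2 * entry h 2 j := by
  change (g.val.val * h.val.val) i j = _
  rw [Matrix.mul_apply, Fin.sum_univ_three]

lemma entry_one (i j : Fin 3) : entry (1 : unitaryG σ) i j = if i = j then 1 else 0 := by
  change (1 : Matrix (Fin 3) (Fin 3) E) i j = _
  rw [Matrix.one_apply]

/-- The relation defining `G` gives `g⁻¹ = J ᵗḡ J`, and `J` reverses the order of the indices. -/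
lemma entry_inv (g : unitaryG σ) (i j : Fin 3) :
    entry g⁻¹ i j = σ (entry g j.rev i.rev) := by
  have h1 : (formJ E * (g.val.val.map σ).transpose * formJ E) * g.val.val = 1 := by
    rw [Matrix.mul_assoc, Matrix.mul_assoc, ← Matrix.mul_assoc _ _ g.val.val,
      show (g.val.val.map σ).transpose * formJ E * g.val.val = formJ E from g.2, formJ_mul_formJ]
  have h2 : (g⁻¹).val.val = formJ E * (g.val.val.map σ).transpose * formJ E := by
    change (g.val⁻¹).val = _
    exact (left_inv_eq_right_inv h1 (by simp)).symm
  change (g⁻¹).val.val i j = _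
  rw [h2]
  fin_cases i <;> fin_cases j <;> 
    simp [formJ, Matrix.mul_apply, Matrix.vecMul, dotProduct, Fin.sum_univ_three, entry, Fin.rev]

/-- The last row of an element of `G` is isotropic. -/
lemma last_row_isotropic (g : unitaryG σ) :
    entry g 2 0 * σ (entry g 2 2) + entry g 2 1 * σ (entry g 2 1) +
      entry g 2 2 * σ (entry g 2 0) = 0 := by
  have h : entry (g * g⁻¹) 2 0 = 0 := by rw [mul_inv_cancel, entry_one]; rfl
  rw [entry_mul] at h
  simpa [entry_inv, Fin.rev] using h

lemma last_row_ne_zero (g : unitaryG σ) :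
    ¬ (entry g 2 0 = 0 ∧ entry g 2 1 = 0 ∧ entry g 2 2 = 0) := by
  rintro ⟨h0, h1, h2⟩
  have h : entry (g * g⁻¹) 2 2 = 1 := by rw [mul_inv_cancel, entry_one]; rfl
  rw [entry_mul, h0, h1, h2] at h
  simp at h

/-- The first column is isotropic: once its last entry vanishes, so does the norm of its middle
entry. -/
lemma mem_borelB_of_last_row {g : unitaryG σ} (h0 : entry g 2 0 = 0) (h1 : entry g 2 1 = 0) :
    g ∈ borelB σ := by
  have h2 : entry g 1 0 = 0 := by
    have := entry_form g 0 0
    simpa [h0, formJ] using this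
  intro i j hij
  fin_cases i <;> fin_cases j <;> simp at hij <;> assumption

/-- The last row of `g k⁻¹` is `ρ` times the last row of `k k⁻¹ = 1`. Hence proportional last rows
mean equal cosets of `B`. -/
lemma mul_inv_mem_borelB {g k : unitaryG σ} (ρ : E)
    (h : ∀ j, entry g 2 j = ρ * entry k 2 j) : g * k⁻¹ ∈ borelB σ := by
  have h1 : ∀ j, entry (g * k⁻¹) 2 j = ρ * entry (k * k⁻¹) 2 j := by
    intro j
    rw [entry_mul, entry_mul, h, h, h]
    ring
  apply mem_borelB_of_last_row <;> rw [h1, mul_inv_cancel, entry_one] <;> simp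

/-- The diagonal element `diag(a, 1, ā⁻¹)` of `G`. -/
def torusElt (σ : E ≃ₐ[F] E) (hinv : ∀ x, σ (σ x) = x) (a : Eˣ) : unitaryG σ :=
  ofMatrix !![(a : E), 0, 0; 0, 1, 0; 0, 0, (σ a)⁻¹] (by
    have : σ (a : E) ≠ 0 := by simp
    intro i j
    fin_cases i <;> fin_cases j <;> simp [formJ, hinv])

/-- The lower triangular unipotent elements of `G`. -/
def lowerElt (hinv : ∀ x, σ (σ x) = x) (x y : E) (h : y + σ y + x * σ x = 0) : unitaryG σ :=
  ofMatrix !![1, 0, 0; x, 1, 0; y, -σ x, 1] (by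
    intro i j
    fin_cases i <;> fin_cases j <;> simp [formJ, hinv]
    linear_combination h)

/-- The product of an antidiagonal element and an upper triangular unipotent element of `G`. -/
def bigCellElt (hinv : ∀ x, σ (σ x) = x) (c s t : E) (hc : c ≠ 0) (h : t + σ t + s * σ s = 0) :
    unitaryG σ :=
  ofMatrix !![0, 0, (σ c)⁻¹; 0, 1, -σ s; c, c * s, c * t] (by
    have : σ c ≠ 0 := by simpa using hc
    intro i j
    fin_cases i <;> fin_cases j <;> simp [formJ, hinv] <;> field_simp
    · ring
    · ring
    · linear_combination h)

/-- The product of a scalar and a central unipotent element of `B`. -/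
def scalarUnipotentElt (lam t : E) (hlam : lam * σ lam = 1) (ht : t + σ t = 0) : unitaryG σ :=
  ofMatrix !![lam, 0, lam * t; 0, lam, 0; 0, 0, lam] (by
    intro i j
    fin_cases i <;> fin_cases j <;> simp [formJ]
    · linear_combination hlam
    · linear_combination hlam
    · linear_combination hlam
    · linear_combination ht * lam * σ lam)

lemma scalarUnipotentElt_mem (lam t : E) (hlam : lam * σ lam = 1) (ht : t + σ t = 0) :
    scalarUnipotentElt lam t hlam ht ∈ borelB σ :=
  mem_borelB_of_last_row rfl rfl

/-- The element is `λ(1 + t e₀₂)`, so its conjugate is `λ` times a rank one perturbation of `1`: the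
first column of `g⁻¹` times the last row of `g`. The former is the latter reversed and conjugated.
-/
lemma entry_conj_scalarUnipotentElt (g : unitaryG σ) (lam t : E) (hlam : lam * σ lam = 1)
    (ht : t + σ t = 0) (i j : Fin 3) :
    entry (g⁻¹ * scalarUnipotentElt lam t hlam ht * g) i j =
      lam * ((if i = j then 1 else 0) + t * σ (entry g 2 i.rev) * entry g 2 j) := by
  have h : entry (g⁻¹ * g) i j = if i = j then 1 else 0 := by rw [inv_mul_cancel, entry_one]
  have h2 : σ (entry g 2 i.rev) = entry g⁻¹ i 0 := by rw [entry_inv]; rfl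
  rw [← h, h2]
  simp only [entry_mul, scalarUnipotentElt, entry_ofMatrix]
  simp
  ring

lemma entry_iota (a : normOne σ) (i j : Fin 3) :
    entry (iota σ a).val i j = if i = j then (a.val : E) else 0 := by
  change Matrix.scalar (Fin 3) (a.val : E) i j = _
  simp [Matrix.diagonal_apply]

/-- Central elements commuting with a regular torus element and a lower unipotent one are
scalar. -/
lemma exists_iota_eq (hinv : ∀ x, σ (σ x) = x) (h2 : (2 : E) ≠ 0) {c : Eˣ} (hc1 : (c : E) ≠ 1)
    (hc2 : (c : E) * σ c ≠ 1) (z : Subgroup.center (unitaryG σ)) : ∃ a, iota σ a = z := by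
  have hz := Subgroup.mem_center_iff.1 z.2
  have hσc : σ (c : E) ≠ 0 := by simp
  have hσc1 : σ (c : E) ≠ 1 := fun h => hc1 (by rw [← hinv c, h, map_one])
  have hσ2 : σ (2 : E) = 2 := map_ofNat σ 2
  -- The diagonal entries `c`, `1`, `σ(c)⁻¹` are distinct, so commuting with this element kills the
  -- off-diagonal entries of `z`.
  have hT := fun i j => congrArg (fun g => entry g i j) (hz (torusElt σ hinv c))
  -- With `x = 1` the equation `y + σ y + x σ x = 0` is solved by `y = -1/2`. Commuting with this
  -- element makes the diagonal entries of `z` equal.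
  have hL := fun i j => congrArg (fun g => entry g i j)
    (hz (lowerElt hinv 1 (-1 / 2) (by simp [hσ2]; field_simp; norm_num)))
  simp only [entry_mul, torusElt, lowerElt, entry_ofMatrix] at hT hL
  have e01 : entry z.val 0 1 = 0 := by
    have := hT 0 1
    simp at this
    by_contra h
    exact hc1 (mul_right_cancel₀ h (by rw [this, one_mul]))
  have e10 : entry z.val 1 0 = 0 := by
    have := hT 1 0
    simp at this
    by_contra h
    exact hc1 (mul_left_cancel₀ h (by rw [← this, mul_one]))
  have e02 : entry z.val 0 2 = 0 := by
    have := hT 0 2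
    simp at this
    field_simp at this
    by_contra h
    apply hc2
    apply mul_right_cancel₀ h
    linear_combination this
  have e20 : entry z.val 2 0 = 0 := by
    have := hT 2 0
    simp at this
    field_simp at this
    by_contra h
    apply hc2
    apply mul_right_cancel₀ h
    linear_combination -this
  have e12 : entry z.val 1 2 = 0 := by
    have := hT 1 2
    simp at this
    field_simp at this
    by_contra h
    apply hσc1
    apply mul_right_cancel₀ h
    linear_combination this
  have e21 : entry z.val 2 1 = 0 := by
    have := hT 2 1
    simp at this
    field_simp at this
    by_contra h
    apply hσc1
    apply mul_right_cancel₀ h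
    linear_combination -this
  have d1 : entry z.val 1 1 = entry z.val 0 0 := by
    have := hL 1 0
    simp [e10, e12] at this
    exact this.symm
  have d2 : entry z.val 2 2 = entry z.val 0 0 := by
    have := hL 2 1
    simp [e01, e21] at this
    rw [← this, d1]
  have hn : entry z.val 0 0 * σ (entry z.val 0 0) = 1 := by
    have := entry_form z.val 1 1
    simp [e01, e21, formJ, d1] at this
    rw [mul_comm, this]
  refine ⟨⟨⟨entry z.val 0 0, σ (entry z.val 0 0), hn, by rw [mul_comm, hn]⟩, hn⟩, ?_⟩
  refine Subtype.ext (entry_ext fun i j => ?_)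
  rw [entry_iota]
  fin_cases i <;> fin_cases j <;> simp [e01, e10, e02, e20, e12, e21, d1, d2]

end UnitaryGroup

/-! ### The groups `K_n` -/

section LevelSubgroup

variable {F E : Type*} [Field F] [Field E] [Algebra F E] [ValuativeRel E] [TopologicalSpace E]
  [IsNonarchimedeanLocalField E] {σ : E ≃ₐ[F] E}

lemma conj_mem_primePow (hval : ∀ x, val E (σ x) = val E x) {n : ℤ} {x : E}
    (hx : x ∈ primePow E n) : σ x ∈ primePow E n := by
  rwa [mem_primePow, hval]

lemma val_eq_one_of_normOne (hval : ∀ x, val E (σ x) = val E x) {x : E} (hx : x * σ x = 1) :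
    val E x = 1 := by
  have h : val E x ^ 2 = 1 := by
    have := congrArg (val E) hx
    rwa [val_mul, hval, val_one, ← pow_two] at this
  exact (pow_eq_one_iff_of_nonneg zero_le two_ne_zero).1 h

/-- The set `K_n` as a subgroup of `G`. -/
def levelSubgroup (hval : ∀ x, val E (σ x) = val E x) (n : ℕ) : Subgroup (unitaryG σ) where
  carrier := levelK σ n
  one_mem' := by
    simp only [levelK, Set.mem_ofPred_eq, entry_one]
    simp [zero_mem_primePow, one_mem_primePow]
  mul_mem' {a b} ha hb := by
    obtain ⟨a00, a01, a02, a10, a11, a12, a20, a21, a22⟩ := ha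
    obtain ⟨b00, b01, b02, b10, b11, b12, b20, b21, b22⟩ := hb
    have one_mem : ∀ {x : E}, x - 1 ∈ primePow E n → x ∈ primePow E 0 := by
      intro x hx
      rw [← sub_add_cancel x 1]
      exact add_mem_primePow (primePow_anti (by omega) hx) one_mem_primePow
    have a11' := one_mem a11
    have b11' := one_mem b11
    simp only [levelK, Set.mem_ofPred_eq, entry_mul]
    have key : ∀ {k : ℤ} {x y z x' y' z' : E} {m₁ m₂ m₃ n₁ n₂ n₃ : ℤ},
        x ∈ primePow E m₁ → x' ∈ primePow E n₁ → y ∈ primePow E m₂ → y' ∈ primePow E n₂ →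
        z ∈ primePow E m₃ → z' ∈ primePow E n₃ → k ≤ m₁ + n₁ → k ≤ m₂ + n₂ → k ≤ m₃ + n₃ →
        x * x' + y * y' + z * z' ∈ primePow E k := by
      intro k x y z x' y' z' m₁ m₂ m₃ n₁ n₂ n₃ hx hx' hy hy' hz hz' h1 h2 h3
      exact add_mem_primePow (add_mem_primePow (mul_mem_primePow hx hx' h1)
        (mul_mem_primePow hy hy' h2)) (mul_mem_primePow hz hz' h3)
    refine ⟨key a00 b00 a01 b10 a02 b20 ?_ ?_ ?_, key a00 b01 a01 b11' a02 b21 ?_ ?_ ?_,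
      key a00 b02 a01 b12 a02 b22 ?_ ?_ ?_, key a10 b00 a11' b10 a12 b20 ?_ ?_ ?_, ?_,
      key a10 b02 a11' b12 a12 b22 ?_ ?_ ?_, key a20 b00 a21 b10 a22 b20 ?_ ?_ ?_,
      key a20 b01 a21 b11' a22 b21 ?_ ?_ ?_, key a20 b02 a21 b12 a22 b22 ?_ ?_ ?_⟩
    case refine_13 =>
      rw [show entry a 1 0 * entry b 0 1 + entry a 1 1 * entry b 1 1 + entry a 1 2 * entry b 2 1 - 1
        = entry a 1 0 * entry b 0 1 + (entry a 1 1 - 1) * entry b 1 1 +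
          entry a 1 2 * entry b 2 1 + (entry b 1 1 - 1) by ring]
      exact add_mem_primePow (key a10 b01 a11 b11' a12 b21 (by omega) (by omega) (by omega)) b11
    all_goals omega
  inv_mem' {a} ha := by
    obtain ⟨a00, a01, a02, a10, a11, a12, a20, a21, a22⟩ := ha
    have h := fun {n : ℤ} {x : E} => conj_mem_primePow hval (n := n) (x := x)
    simp only [levelK, Set.mem_ofPred_eq, entry_inv]
    refine ⟨h a22, h a12, h a02, h a21, ?_, h a01, h a20, h a10, h a00⟩
    have := h a11
    rwa [map_sub, map_one] at this

lemma continuous_entry (i j : Fin 3) : Continuous fun g : unitaryG σ => entry g i j :=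
  (Units.continuous_val.comp continuous_subtype_val).matrix_elem i j

lemma isOpen_levelK (n : ℕ) : IsOpen (levelK σ n) := by
  have h : ∀ (i j : Fin 3) (m : ℤ), IsOpen {g : unitaryG σ | entry g i j ∈ primePow E m} :=
    fun i j m => (isOpen_primePow m).preimage (continuous_entry i j)
  refine (h _ _ _).inter <| (h _ _ _).inter <| (h _ _ _).inter <| (h _ _ _).inter <|
    IsOpen.inter ?_ <| (h _ _ _).inter <| (h _ _ _).inter <| (h _ _ _).inter <| h _ _ _
  exact (isOpen_primePow n).preimage ((continuous_entry 1 1).sub continuous_const)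

lemma torusElt_mem_levelK (hinv : ∀ x, σ (σ x) = x) (hval : ∀ x, val E (σ x) = val E x)
    {a : Eˣ} (ha : val E (a : E) = 1) (n : ℕ) : torusElt σ hinv a ∈ levelK σ n := by
  simp [levelK, torusElt, zero_mem_primePow, mem_primePow_zero, ha, hval]

lemma iota_mem_levelK (hval : ∀ x, val E (σ x) = val E x) {n : ℕ} {a : normOne σ}
    (ha : a ∈ normOneLevel σ n) : (iota σ a).val ∈ levelK σ n := by
  have h1 : val E (a.val : E) = 1 := val_eq_one_of_normOne hval a.2
  have h0 : (a.val : E) ∈ primePow E 0 := mem_primePow_zero.2 h1.le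
  simp only [levelK, Set.mem_ofPred_eq, entry_iota]
  simp only [Fin.isValue, ↓reduceIte, h0, zero_ne_one, zero_mem_primePow, Fin.reduceEq, true_and,
    and_true, one_ne_zero]
  rcases ha with rfl | ha
  · exact sub_mem_primePow h0 one_mem_primePow
  · exact ha

end LevelSubgroup

/-! ### Fixed vectors of the induced representation and the double cosets of `B` and `K_n` -/

section Induced

variable {F E : Type*} [Field F] [Field E] [Algebra F E] [ValuativeRel E] [TopologicalSpace E]
  [IsNonarchimedeanLocalField E] {σ : E ≃ₐ[F] E}

lemma normAbs_nonneg (x : E) : 0 ≤ normAbs E x := NNReal.coe_nonneg _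

lemma sqrt_modulusB (b : borelB σ) :
    Real.sqrt (modulusB b) = normAbs E (entry b.val 0 0) :=
  Real.sqrt_sq (normAbs_nonneg _)

/-- The factor of automorphy `δ_B^{1/2} μ` of the induced representation. -/
noncomputable def weight (μ : borelB σ →* ℂˣ) : borelB σ →* ℂ where
  toFun b := (Real.sqrt (modulusB b) : ℂ) * (μ b : ℂ)
  map_one' := by
    rw [sqrt_modulusB, OneMemClass.coe_one, entry_one]
    simp [normAbs_eq_one]
  map_mul' a b := by
    rw [sqrt_modulusB, sqrt_modulusB, sqrt_modulusB, diag_mul]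
    simp only [normAbs, val_mul, map_mul, NNReal.coe_mul, Complex.ofReal_mul, Units.val_mul]
    ring

lemma apply_borel_mul {μ : borelB σ →* ℂˣ} (f : inducedSpace μ) (b : borelB σ)
    (g : unitaryG σ) : f.val (b.val * g) = weight μ b * f.val g := f.2.2 b g

lemma weight_tensorChar (μ₁ : Eˣ →ₜ* ℂˣ) (μ₂ : normOne σ →ₜ* ℂˣ) (b : borelB σ) (a : Eˣ)
    (d : normOne σ) (ha : entry b.val 0 0 = a) (hd : entry b.val 1 1 = d.val)
    (hva : val E (a : E) = 1) :
    weight (tensorChar μ₁ μ₂) b = μ₁ a * μ₂ d := by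
  have h1 : diagEntry σ 0 b = a := Units.ext ha
  have h2 : midEntry σ b = d := Subtype.ext (Units.ext hd)
  change (Real.sqrt (modulusB b) : ℂ) * ((μ₁ (diagEntry σ 0 b) * μ₂ (midEntry σ b) : ℂˣ) : ℂ) = _
  rw [sqrt_modulusB, ha, normAbs_eq_one hva, h1, h2]
  simp

/-- A double coset `B g K_n` on whose stabilizer in `B` the factor of automorphy is trivial
supports a `K_n`-fixed vector. -/
lemma fixedVectors_ne_bot_of_weight (hval : ∀ x, val E (σ x) = val E x) (μ : borelB σ →* ℂˣ)
    (n : ℕ) (g : unitaryG σ)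
    (h : ∀ b : borelB σ, g⁻¹ * b.val * g ∈ levelK σ n → weight μ b = 1) :
    fixedVectors (parabolicInd μ) n ≠ ⊥ := by
  classical
  let K := levelSubgroup hval n
  -- If `x` lies in both `b g K` and `b' g K`, then `b⁻¹b'` lies in the stabilizer `B ∩ gKg⁻¹`,
  -- where the weight is trivial. So `b g k ↦ weight b` is well defined.
  have hwd : ∀ (b b' : borelB σ) (x : unitaryG σ), g⁻¹ * b.val⁻¹ * x ∈ K →
      g⁻¹ * b'.val⁻¹ * x ∈ K → weight μ b = weight μ b' := by
    intro b b' x hb hb'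
    have h1 := h (b⁻¹ * b') (by
      have := K.mul_mem hb (K.inv_mem hb')
      change _ ∈ K
      convert this using 1
      simp only [Subgroup.coe_mul, Subgroup.coe_inv]
      group)
    rw [show b' = b * (b⁻¹ * b') by group, map_mul, h1, mul_one]
  let φ : unitaryG σ → ℂ := fun x =>
    if hx : ∃ b : borelB σ, g⁻¹ * b.val⁻¹ * x ∈ K then weight μ hx.choose else 0
  have hφ : ∀ (b : borelB σ) (x : unitaryG σ), g⁻¹ * b.val⁻¹ * x ∈ K → φ x = weight μ b := by
    intro b x hb
    have hx : ∃ b : borelB σ, g⁻¹ * b.val⁻¹ * x ∈ K := ⟨b, hb⟩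
    simp only [φ, dif_pos hx]
    exact hwd _ _ x hx.choose_spec hb
  have hφ0 : ∀ x : unitaryG σ, (¬ ∃ b : borelB σ, g⁻¹ * b.val⁻¹ * x ∈ K) → φ x = 0 :=
    fun x hx => dif_neg hx
  have hφK : ∀ (x k : unitaryG σ), k ∈ K → φ (x * k) = φ x := by
    intro x k hk
    by_cases hx : ∃ b : borelB σ, g⁻¹ * b.val⁻¹ * x ∈ K
    · obtain ⟨b, hb⟩ := hx
      rw [hφ b x hb, hφ b (x * k) (by rw [← mul_assoc]; exact K.mul_mem hb hk)]
    · rw [hφ0 x hx, hφ0]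
      rintro ⟨b, hb⟩
      refine hx ⟨b, ?_⟩
      rw [← mul_assoc] at hb
      exact (K.mul_mem_cancel_right hk).1 hb
  have hφB : ∀ (b : borelB σ) (x : unitaryG σ), φ (b.val * x) = weight μ b * φ x := by
    intro b x
    have hiff : ∀ b' : borelB σ, g⁻¹ * (b * b').val⁻¹ * (b.val * x) = g⁻¹ * b'.val⁻¹ * x := by
      intro b'
      simp only [Subgroup.coe_mul]
      group
    by_cases hx : ∃ b : borelB σ, g⁻¹ * b.val⁻¹ * x ∈ K
    · obtain ⟨b', hb⟩ := hx
      rw [hφ b' x hb, hφ (b * b') (b.val * x) (by rwa [hiff]), map_mul]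
    · rw [hφ0 x hx, hφ0, mul_zero]
      rintro ⟨b', hb⟩
      refine hx ⟨b⁻¹ * b', ?_⟩
      rwa [← hiff, mul_inv_cancel_left]
  have hloc : IsLocallyConstant φ := by
    rw [IsLocallyConstant.iff_exists_open]
    intro x
    refine ⟨(fun y => x⁻¹ * y) ⁻¹' levelK σ n,
      (isOpen_levelK n).preimage (continuous_const_mul x⁻¹), ?_, fun y hy => ?_⟩
    · change x⁻¹ * x ∈ K
      rw [inv_mul_cancel]
      exact K.one_mem
    · rw [← hφK x (x⁻¹ * y) hy, mul_inv_cancel_left]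
  rw [Submodule.ne_bot_iff]
  refine ⟨⟨φ, hloc, hφB⟩, fun k hk => Subtype.ext (funext fun x => hφK x k hk), fun h0 => ?_⟩
  have h1 : φ g = 0 := congrFun (congrArg Subtype.val h0) g
  rw [hφ 1 g (by simp [K.one_mem]), map_one] at h1
  exact one_ne_zero h1

lemma apply_mul_of_mem_fixedVectors {μ : borelB σ →* ℂˣ} {n : ℕ} {f : inducedSpace μ}
    (hf : f ∈ fixedVectors (parabolicInd μ) n) {k : unitaryG σ} (hk : k ∈ levelK σ n)
    (g : unitaryG σ) : f.val (g * k) = f.val g :=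
  congrFun (congrArg Subtype.val (hf k hk)) g

lemma exists_apply_ne_zero {μ : borelB σ →* ℂˣ} {f : inducedSpace μ} (hf : f ≠ 0) :
    ∃ g, f.val g ≠ 0 := by
  by_contra! h
  exact hf (Subtype.ext (funext h))

lemma iota_mem_borelB (a : normOne σ) : (iota σ a).val ∈ borelB σ := by
  apply mem_borelB_of_last_row <;> simp [entry_iota]

/-- Scalars act on the induced representation through `μ₁ μ₂`. -/
lemma parabolicInd_iota (hval : ∀ x, val E (σ x) = val E x) (μ₁ : Eˣ →ₜ* ℂˣ)
    (μ₂ : normOne σ →ₜ* ℂˣ) (a : normOne σ) (f : inducedSpace (tensorChar μ₁ μ₂)) :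
    parabolicInd (tensorChar μ₁ μ₂) (iota σ a).val f = ((μ₁ a.val : ℂ) * (μ₂ a : ℂ)) • f := by
  refine Subtype.ext (funext fun g => ?_)
  change f.val (g * (iota σ a).val) = ((μ₁ a.val : ℂ) * (μ₂ a : ℂ)) * f.val g
  rw [(Subgroup.mem_center_iff.1 (iota σ a).2 g),
    apply_borel_mul f ⟨_, iota_mem_borelB a⟩ g,
    weight_tensorChar μ₁ μ₂ _ a.val a (by simp [entry_iota]) (by simp [entry_iota])
      (val_eq_one_of_normOne hval a.2)]

lemma centralCharacter_iota (hval : ∀ x, val E (σ x) = val E x) {μ₁ : Eˣ →ₜ* ℂˣ}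
    {μ₂ : normOne σ →ₜ* ℂˣ} {ω : Subgroup.center (unitaryG σ) →* ℂˣ}
    (hω : IsCentralCharacter (parabolicInd (tensorChar μ₁ μ₂)) ω)
    {f : inducedSpace (tensorChar μ₁ μ₂)} (hf : f ≠ 0) (a : normOne σ) :
    ω (iota σ a) = μ₁ a.val * μ₂ a := by
  have h := hω (iota σ a) f
  rw [parabolicInd_iota hval] at h
  exact Units.ext (by simpa using (smul_left_injective ℂ hf h).symm)

/-- The center consists of scalars, hence lies in `B`, and the inducing character restricts to it;
the modulus is trivial on norm-one scalars. The nonzero vector `f` serves for uniqueness. -/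
lemma existsUnique_centralCharacter (hinv : ∀ x, σ (σ x) = x)
    (hval : ∀ x, val E (σ x) = val E x) (h2 : (2 : E) ≠ 0) (μ₁ : Eˣ →ₜ* ℂˣ)
    (μ₂ : normOne σ →ₜ* ℂˣ) {f : inducedSpace (tensorChar μ₁ μ₂)} (hf : f ≠ 0) :
    ∃! ω, IsCentralCharacter (parabolicInd (tensorChar μ₁ μ₂)) ω := by
  -- The inverse of a uniformizer: neither `c` nor `c · σ c` has valuation `1`, so neither equals
  -- `1`.
  obtain ⟨c, hc0, hc⟩ := exists_val_eq_exp (E := E) 1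
  have hsurj : ∀ z : Subgroup.center (unitaryG σ), ∃ a, iota σ a = z := by
    refine exists_iota_eq hinv h2 (c := Units.mk0 c hc0) ?_ ?_
    · intro h
      rw [Units.val_mk0] at h
      rw [h, val_one, ← WithZero.exp_zero, WithZero.exp_inj] at hc
      omega
    · intro h
      have := congrArg (val E) h
      rw [val_mul, hval, Units.val_mk0, hc, val_one, ← WithZero.exp_add, ← WithZero.exp_zero,
        WithZero.exp_inj] at this
      omega
  have hmem : Subgroup.center (unitaryG σ) ≤ borelB σ := by
    intro z hz
    obtain ⟨a, ha⟩ := hsurj ⟨z, hz⟩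
    have := iota_mem_borelB a
    rwa [ha] at this
  let ω₀ : Subgroup.center (unitaryG σ) →* ℂˣ :=
    (tensorChar μ₁ μ₂).comp (Subgroup.inclusion hmem)
  have hω₀ : ∀ a, ω₀ (iota σ a) = μ₁ a.val * μ₂ a := by
    intro a
    have h1 : diagEntry σ 0 (Subgroup.inclusion hmem (iota σ a)) = a.val :=
      Units.ext (by change entry (iota σ a).val 0 0 = _; simp [entry_iota])
    have h2 : midEntry σ (Subgroup.inclusion hmem (iota σ a)) = a :=
      Subtype.ext (Units.ext (by change entry (iota σ a).val 1 1 = _; simp [entry_iota]))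
    change μ₁ (diagEntry σ 0 _) * μ₂ (midEntry σ _) = _
    rw [h1, h2]
  refine ⟨ω₀, ?_, fun ω hω => ?_⟩
  · intro z v
    obtain ⟨a, rfl⟩ := hsurj z
    rw [parabolicInd_iota hval, hω₀, Units.val_mul]
  · ext z
    obtain ⟨a, rfl⟩ := hsurj z
    rw [centralCharacter_iota hval hω hf, hω₀]

/-- If the last row of `g` is divisible by its third entry in the sense of `K_n`, then
`g ∈ B K_n`. -/
lemma exists_mul_inv_mem_borelB_lower (hinv : ∀ x, σ (σ x) = x)
    (hval : ∀ x, val E (σ x) = val E x) (n : ℕ) (g : unitaryG σ)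
    (h0 : val E (entry g 2 0) ≤ val E (entry g 2 2) * WithZero.exp (-(n : ℤ)))
    (h1 : val E (entry g 2 1) ≤ val E (entry g 2 2) * WithZero.exp (-(n : ℤ))) :
    ∃ k ∈ levelK σ n, g * k⁻¹ ∈ borelB σ := by
  have hr : entry g 2 2 ≠ 0 := by
    intro h
    rw [h, val_zero, zero_mul, le_zero_iff, val_eq_zero] at h0 h1
    exact last_row_ne_zero g ⟨h0, h1, h⟩
  have hσr : σ (entry g 2 2) ≠ 0 := by simpa using hr
  have hpos : 0 < val E (entry g 2 2) := by simpa [zero_lt_iff] using hr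
  have hy : entry g 2 0 / entry g 2 2 ∈ primePow E n := by
    rw [mem_primePow, val_div, div_le_iff₀ hpos, mul_comm]
    exact h0
  have hx : entry g 2 1 / entry g 2 2 ∈ primePow E n := by
    rw [mem_primePow, val_div, div_le_iff₀ hpos, mul_comm]
    exact h1
  have hx' : -σ (entry g 2 1 / entry g 2 2) ∈ primePow E n :=
    neg_mem_primePow (conj_mem_primePow hval hx)
  -- The lower unipotent element whose last row is that of `g` divided by its third entry; it lies
  -- in `G` because that row is isotropic.
  refine ⟨lowerElt hinv (-σ (entry g 2 1 / entry g 2 2)) (entry g 2 0 / entry g 2 2) ?_, ?_,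
    mul_inv_mem_borelB (entry g 2 2) ?_⟩
  · have := last_row_isotropic g
    simp only [map_div₀, map_neg, hinv]
    field_simp
    linear_combination this
  · simp [levelK, lowerElt, zero_mem_primePow, one_mem_primePow, hy, hx', hinv, - map_div₀]
    exact hx
  · intro j
    fin_cases j <;> simp [lowerElt, hinv] <;> field_simp

/-- If the last row of `g` is divisible by its first entry in the sense of `K_n`, then
`g ∈ B K_n`. -/
lemma exists_mul_inv_mem_borelB_upper (hinv : ∀ x, σ (σ x) = x)
    (hval : ∀ x, val E (σ x) = val E x) (n : ℕ) (g : unitaryG σ)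
    (h1 : val E (entry g 2 1) ≤ val E (entry g 2 0))
    (h2 : val E (entry g 2 2) * WithZero.exp (-(n : ℤ)) ≤ val E (entry g 2 0)) :
    ∃ k ∈ levelK σ n, g * k⁻¹ ∈ borelB σ := by
  have hr : entry g 2 0 ≠ 0 := by
    intro h
    rw [h, val_zero, le_zero_iff] at h1 h2
    rw [val_eq_zero] at h1
    rw [mul_eq_zero, val_eq_zero] at h2
    exact last_row_ne_zero g ⟨h, h1, h2.resolve_right WithZero.exp_ne_zero⟩
  have hσr : σ (entry g 2 0) ≠ 0 := by simpa using hr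
  have hpos : 0 < val E (entry g 2 0) := by simpa [zero_lt_iff] using hr
  -- The last row of `g` is rescaled to have first entry `c`. The exact valuation is needed: `c`
  -- must lie in `𝔭ⁿ` and `σ(c)⁻¹` in `𝔭⁻ⁿ`.
  obtain ⟨c, hc0, hc⟩ := exists_val_eq_exp (E := E) (-(n : ℤ))
  have hs : entry g 2 1 / entry g 2 0 ∈ primePow E 0 := by
    rw [mem_primePow_zero, val_div, div_le_iff₀ hpos, one_mul]
    exact h1
  have hct : c * (entry g 2 2 / entry g 2 0) ∈ primePow E 0 := by
    rw [mem_primePow_zero, val_mul, val_div, hc, mul_comm, div_mul_eq_mul_div, div_le_iff₀ hpos,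
      one_mul]
    exact h2
  have hcn : c ∈ primePow E n := mem_primePow.2 hc.le
  have hci : (σ c)⁻¹ ∈ primePow E (-(n : ℤ)) := by
    rw [mem_primePow, val_inv, hval, hc, neg_neg, WithZero.exp_neg, inv_inv]
  have hcs : c * (entry g 2 1 / entry g 2 0) ∈ primePow E n := mul_mem_primePow hcn hs (by simp)
  refine ⟨bigCellElt hinv c (entry g 2 1 / entry g 2 0) (entry g 2 2 / entry g 2 0) hc0 ?_, ?_,
    mul_inv_mem_borelB (entry g 2 0 / c) ?_⟩
  · have := last_row_isotropic g
    simp only [map_div₀]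
    field_simp
    linear_combination this
  · exact ⟨zero_mem_primePow _, zero_mem_primePow _, hci, zero_mem_primePow _,
      by simpa [bigCellElt] using zero_mem_primePow (E := E) n,
      neg_mem_primePow (conj_mem_primePow hval hs), hcn, hcs, hct⟩
  · intro j
    fin_cases j <;> simp [bigCellElt] <;> field_simp

/-- If the last row of `g` is far from the two lines above, then `K_n` contains conjugates of
elements of `B` acting by arbitrary scalars in `E¹_{n-1}` up to unipotents. -/
lemma exists_scalarUnipotentElt_conj_mem_levelK (hinv : ∀ x, σ (σ x) = x)
    (hval : ∀ x, val E (σ x) = val E x) (h2 : val E (2 : E) = 1) {n : ℕ} (g : unitaryG σ)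
    (h0 : val E (entry g 2 0) < val E (entry g 2 1))
    (h1 : val E (entry g 2 2) * WithZero.exp (-(n : ℤ)) < val E (entry g 2 1)) :
    2 ≤ n ∧ ∀ (lam : E) (hlam : lam * σ lam = 1), lam - 1 ∈ primePow E ((n : ℤ) - 1) →
      ∃ (t : E) (ht : t + σ t = 0),
        g⁻¹ * scalarUnipotentElt lam t hlam ht * g ∈ levelK σ n := by
  set p := entry g 2 0
  set q := entry g 2 1
  set r := entry g 2 2
  have hq : q ≠ 0 := by
    intro h
    simp [h] at h0
  have hσq : σ q ≠ 0 := by simpa using hq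
  have hpos : 0 < val E q := by simpa [zero_lt_iff] using hq
  have h20 : (2 : E) ≠ 0 := by
    intro h
    simp [h] at h2
  -- The last row is `q(α, 1, γ)`, and the strict inequalities become `α ∈ 𝔭` and `γ ∈ 𝔭¹⁻ⁿ`.
  obtain ⟨α, hα⟩ : ∃ α, p = α * q := ⟨p / q, by field_simp⟩
  obtain ⟨γ, hγ⟩ : ∃ γ, r = γ * q := ⟨r / q, by field_simp⟩
  have hα1 : α ∈ primePow E 1 := by
    rw [hα, val_mul, mul_lt_iff_lt_one_left hpos] at h0
    rcases eq_or_ne α 0 with rfl | hα0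
    · exact zero_mem_primePow 1
    obtain ⟨m, hm⟩ := exists_exp_eq_val hα0
    rw [hm, ← WithZero.exp_zero, WithZero.exp_lt_exp] at h0
    rw [mem_primePow, hm, WithZero.exp_le_exp]
    omega
  have hγ1 : γ ∈ primePow E (1 - (n : ℤ)) := by
    rw [hγ, val_mul, mul_right_comm, mul_lt_iff_lt_one_left hpos] at h1
    rcases eq_or_ne γ 0 with rfl | hγ0
    · exact zero_mem_primePow _
    obtain ⟨m, hm⟩ := exists_exp_eq_val hγ0
    rw [hm, ← WithZero.exp_add, ← WithZero.exp_zero, WithZero.exp_lt_exp] at h1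
    rw [mem_primePow, hm, WithZero.exp_le_exp]
    omega
  have hσα := conj_mem_primePow hval hα1
  have hσγ := conj_mem_primePow hval hγ1
  -- Isotropy reads `α σ(γ) + γ σ(α) = -1`, with left side in `𝔭²⁻ⁿ`; for `n ≤ 1` this would put
  -- `-1` in `𝔭`.
  have hn : 2 ≤ n := by
    by_contra! hn
    have hiso : α * σ γ + γ * σ α = -1 := by
      have := last_row_isotropic g
      change p * σ r + q * σ q + r * σ p = 0 at this
      rw [hα, hγ, map_mul, map_mul] at this
      have h3 : (α * σ γ + γ * σ α + 1) * (q * σ q) = 0 := by linear_combination this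
      have := (mul_eq_zero.1 h3).resolve_right (mul_ne_zero hq hσq)
      linear_combination this
    have hmem : (-1 : E) ∈ primePow E 1 := by
      rw [← hiso]
      exact add_mem_primePow (mul_mem_primePow hα1 hσγ (by omega))
        (mul_mem_primePow hγ1 hσα (by omega))
    rw [mem_primePow, val_neg, val_one, ← WithZero.exp_zero, WithZero.exp_le_exp] at hmem
    omega
  refine ⟨hn, fun lam hlam hlam1 => ?_⟩
  have hlam0 : lam ∈ primePow E 0 :=
    mem_primePow_zero.2 (val_eq_one_of_normOne hval hlam).le
  have hhalf : (2 : E)⁻¹ ∈ primePow E 0 := mem_primePow_zero.2 (by simp [h2])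
  have hσ2 : σ (2 : E) = 2 := map_ofNat σ 2
  -- The middle entry of the conjugate will be `λ(1 + τ)`, to be made `1` modulo `𝔭ⁿ` by a `τ` of
  -- trace zero. So `τ` is the trace-zero part of `1 - λ`; dividing it by `q σ(q)` offsets the
  -- scaling of the row.
  obtain ⟨τ, hτ⟩ : ∃ τ : E, τ = -((lam - 1) - σ (lam - 1)) * 2⁻¹ := ⟨_, rfl⟩
  have hσl := conj_mem_primePow hval hlam1
  have hτ1 : τ ∈ primePow E ((n : ℤ) - 1) := by
    rw [hτ]
    exact mul_mem_primePow (neg_mem_primePow (sub_mem_primePow hlam1 hσl)) hhalf (by omega)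
  have hτσ : τ + σ τ = 0 := by
    rw [hτ]
    simp only [map_mul, map_neg, map_sub, map_inv₀, hσ2, hinv, map_one]
    ring
  refine ⟨τ / (q * σ q), ?_, ?_⟩
  · simp only [map_div₀, map_mul, hinv]
    rw [mul_comm (σ q) q, ← add_div, hτσ, zero_div]
  have hent : ∀ i j, entry (g⁻¹ * scalarUnipotentElt lam (τ / (q * σ q)) hlam (by
      simp only [map_div₀, map_mul, hinv]
      rw [mul_comm (σ q) q, ← add_div, hτσ, zero_div]) * g) i j =
      lam * ((if i = j then 1 else 0) + τ * (![σ γ, 1, σ α] i * ![α, 1, γ] j)) := by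
    intro i j
    rw [entry_conj_scalarUnipotentElt]
    congr 2
    have hi : σ (entry g 2 i.rev) = ![σ γ, 1, σ α] i * σ q := by
      fin_cases i
      · change σ r = σ γ * σ q
        rw [hγ, map_mul]
      · change σ q = 1 * σ q
        rw [one_mul]
      · change σ p = σ α * σ q
        rw [hα, map_mul]
    have hj : entry g 2 j = ![α, 1, γ] j * q := by
      fin_cases j
      · exact hα
      · exact (one_mul q).symm
      · exact hγ
    rw [hi, hj]
    field_simp
  have hone : (1 : E) ∈ primePow E 0 := one_mem_primePow
  have hzero : ∀ m, (0 : E) ∈ primePow E m := zero_mem_primePow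
  have key : ∀ {k m₁ m₂ : ℤ} {δ x y : E}, δ ∈ primePow E k → x ∈ primePow E m₁ →
      y ∈ primePow E m₂ → k ≤ (n : ℤ) - 1 + (m₁ + m₂) →
      lam * (δ + τ * (x * y)) ∈ primePow E k := by
    intro k m₁ m₂ δ x y hδ hx hy h
    exact mul_mem_primePow hlam0 (add_mem_primePow hδ
      (mul_mem_primePow hτ1 (mul_mem_primePow hx hy le_rfl) h)) (by omega)
  simp only [levelK, Set.mem_ofPred_eq, hent]
  -- Outside the middle entry, `τ ∈ 𝔭ⁿ⁻¹` and the bounds on `α`, `γ` match the shape of `K_n`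
  -- directly.
  refine ⟨key hone hσγ hα1 ?_, key (hzero _) hσγ hone ?_, key (hzero _) hσγ hγ1 ?_,
    key (hzero _) hone hα1 ?_, ?_, key (hzero _) hone hγ1 ?_, key (hzero _) hσα hα1 ?_,
    key (hzero _) hσα hone ?_, key hone hσα hγ1 ?_⟩
  case refine_5 =>
    -- Since `λ` has norm one, the trace of `λ - 1` is minus its norm. The error is therefore
    -- quadratic, in `𝔭²ⁿ⁻²`, which lies in `𝔭ⁿ` as `n ≥ 2`.
    have h3 : lam * (1 + τ * (1 * 1)) - 1 = -((lam - 1) * σ (lam - 1)) * 2⁻¹ + (lam - 1) * τ := by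
      have h4 : lam * σ lam = 1 := hlam
      have h5 : (lam - 1) + σ (lam - 1) = -((lam - 1) * σ (lam - 1)) := by
        rw [map_sub, map_one]
        linear_combination h4
      have h6 : -((lam - 1) * σ (lam - 1)) * 2⁻¹ = (lam - 1) + τ := by
        rw [← h5, hτ]
        field_simp
        ring
      rw [h6]
      ring
    change lam * ((if True then 1 else 0) + τ * (1 * 1)) - 1 ∈ _
    rw [if_pos trivial, h3]
    exact add_mem_primePow (mul_mem_primePow (neg_mem_primePow
      (mul_mem_primePow hlam1 hσl le_rfl)) hhalf (by omega)) (mul_mem_primePow hlam1 hτ1 (by omega))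
  all_goals omega

/-- A nonzero `K_n`-fixed vector is supported on `B K_n`, unless the central character has
conductor less than `n`. -/
lemma apply_one_ne_zero_or (hinv : ∀ x, σ (σ x) = x) (hval : ∀ x, val E (σ x) = val E x)
    (h2 : val E (2 : E) = 1) {μ₁ : Eˣ →ₜ* ℂˣ} {μ₂ : normOne σ →ₜ* ℂˣ} {n : ℕ}
    {f : inducedSpace (tensorChar μ₁ μ₂)}
    (hf : f ∈ fixedVectors (parabolicInd (tensorChar μ₁ μ₂)) n) {g : unitaryG σ}
    (hg : f.val g ≠ 0) :
    f.val 1 ≠ 0 ∨ (2 ≤ n ∧ ∀ a ∈ normOneLevel σ (n - 1), μ₁ a.val * μ₂ a = 1) := by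
  have hcell : (∃ k ∈ levelK σ n, g * k⁻¹ ∈ borelB σ) → f.val 1 ≠ 0 := by
    rintro ⟨k, hk, hb⟩ h1
    apply hg
    have h3 : f.val k = 0 := by
      rw [← one_mul k, apply_mul_of_mem_fixedVectors hf hk, h1]
    have h4 := apply_borel_mul f ⟨g * k⁻¹, hb⟩ k
    rwa [h3, mul_zero, inv_mul_cancel_right] at h4
  rcases le_or_gt (val E (entry g 2 1)) (val E (entry g 2 0)) with h10 | h10
  · left
    rcases le_or_gt (val E (entry g 2 2) * WithZero.exp (-(n : ℤ))) (val E (entry g 2 0))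
      with h20 | h20
    · exact hcell (exists_mul_inv_mem_borelB_upper hinv hval n g h10 h20)
    · exact hcell (exists_mul_inv_mem_borelB_lower hinv hval n g h20.le (h10.trans h20.le))
  rcases le_or_gt (val E (entry g 2 1)) (val E (entry g 2 2) * WithZero.exp (-(n : ℤ)))
    with h12 | h12
  · left
    exact hcell (exists_mul_inv_mem_borelB_lower hinv hval n g (h10.le.trans h12) h12)
  · right
    obtain ⟨hn, H⟩ := exists_scalarUnipotentElt_conj_mem_levelK hinv hval h2 g h10 h12
    refine ⟨hn, fun a ha => ?_⟩
    have ha' : (a.val : E) - 1 ∈ primePow E ((n : ℤ) - 1) := by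
      have := ha.resolve_left (by omega)
      rwa [Nat.cast_sub (by omega), Nat.cast_one] at this
    obtain ⟨t, ht, hk⟩ := H a.val a.2 ha'
    -- With `k = g⁻¹ug ∈ K_n` and `u ∈ B`, the value `f(gk) = f(ug)` equals both `f(g)` and
    -- `μ₁(a)μ₂(a) f(g)`.
    have h3 := apply_mul_of_mem_fixedVectors hf hk g
    rw [← mul_assoc, ← mul_assoc, mul_inv_cancel, one_mul,
      apply_borel_mul f ⟨_, scalarUnipotentElt_mem _ t a.2 ht⟩ g,
      weight_tensorChar μ₁ μ₂ _ a.val a rfl rfl (val_eq_one_of_normOne hval a.2)] at h3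
    have h4 := mul_right_cancel₀ hg (h3.trans (one_mul _).symm)
    exact Units.ext (by simpa using h4)

end Induced

/-! ### Existence of newforms and comparison of conductors -/

section Conductor

variable {F E : Type*} [Field F] [Field E] [Algebra F E] [ValuativeRel E] [TopologicalSpace E]
  [IsNonarchimedeanLocalField E] {σ : E ≃ₐ[F] E}

lemma exists_trivialAtLevel (μ₁ : Eˣ →ₜ* ℂˣ) :
    ∃ n : ℕ, 1 ≤ n ∧ ∀ a : Eˣ, (a : E) - 1 ∈ primePow E n → μ₁ a = 1 :=
  exists_trivial_of_continuous (MonoidHom.id Eˣ) Topology.IsInducing.id μ₁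

lemma exists_trivialAtLevel₁ (μ₂ : normOne σ →ₜ* ℂˣ) :
    ∃ n : ℕ, 1 ≤ n ∧ ∀ a : normOne σ, (a.val : E) - 1 ∈ primePow E n → μ₂ a = 1 :=
  exists_trivial_of_continuous (normOne σ).subtype Topology.IsInducing.subtypeVal μ₂

/-- The infimum of the empty set is also `0`; continuity of `μ₁` excludes that reading. -/
lemma unramified_iff (μ₁ : Eˣ →ₜ* ℂˣ) :
    Unramified μ₁ ↔ ∀ a : Eˣ, val E (a : E) = 1 → μ₁ a = 1 := by
  obtain ⟨n, -, hn⟩ := exists_trivialAtLevel μ₁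
  have h0 : TrivialAtLevel μ₁ 0 ↔ ∀ a : Eˣ, val E (a : E) = 1 → μ₁ a = 1 := by
    refine ⟨fun h a ha => h a ha ?_, fun h a ha _ => h a ha⟩
    exact sub_mem_primePow (mem_primePow_zero.2 ha.le) one_mem_primePow
  rw [← h0, Unramified, conductor, Nat.sInf_eq_zero]
  refine or_iff_left fun h => ?_
  have : n ∈ ({n | TrivialAtLevel μ₁ n} : Set ℕ) := fun a _ ha => hn a ha
  rw [h] at this
  exact this

/-- The parabolic induction admits a newform: at a high level the vector supported on the double
coset of a suitable lower unipotent element is fixed. -/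
lemma admitsNewform_parabolicInd (hinv : ∀ x, σ (σ x) = x) (hval : ∀ x, val E (σ x) = val E x)
    (h2 : val E (2 : E) = 1) (μ₁ : Eˣ →ₜ* ℂˣ) (μ₂ : normOne σ →ₜ* ℂˣ) :
    AdmitsNewform (parabolicInd (tensorChar μ₁ μ₂)) := by
  obtain ⟨m₁, hm₁, H₁⟩ := exists_trivialAtLevel μ₁
  obtain ⟨m₂, hm₂, H₂⟩ := exists_trivialAtLevel₁ μ₂
  obtain ⟨m, hm⟩ : ∃ m, m = max m₁ m₂ := ⟨_, rfl⟩
  have h1m : m₁ ≤ m := hm ▸ le_max_left _ _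
  have h2m : m₂ ≤ m := hm ▸ le_max_right _ _
  -- At level `4m`, valuation `3m` works on both sides: `𝔭⁴ᵐx⁻¹ = 𝔭ᵐ`, while `x σ(x)` and `y` lie in
  -- `𝔭⁶ᵐ` and absorb the entry in `𝔭⁻⁴ᵐ`.
  obtain ⟨x, hx0, hx⟩ := exists_val_eq_exp (E := E) (-(3 * m : ℤ))
  have h20 : (2 : E) ≠ 0 := by
    intro h
    simp [h] at h2
  have hσ2 : σ (2 : E) = 2 := map_ofNat σ 2
  obtain ⟨y, hy⟩ : ∃ y : E, y = -(x * σ x) * 2⁻¹ := ⟨_, rfl⟩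
  have hσy : σ y = y := by
    rw [hy]
    simp [hinv, hσ2, mul_comm]
  have hxy : y + σ y + x * σ x = 0 := by
    rw [hσy, hy]
    field_simp
    ring
  have hxm : x ∈ primePow E (3 * m) := mem_primePow.2 hx.le
  have hσx := conj_mem_primePow hval hxm
  have hhalf : (2 : E)⁻¹ ∈ primePow E 0 := mem_primePow_zero.2 (by simp [h2])
  have hym : y ∈ primePow E (6 * m) := by
    rw [hy]
    exact mul_mem_primePow (neg_mem_primePow (mul_mem_primePow hxm hσx le_rfl)) hhalf (by omega)
  have hxi : x⁻¹ ∈ primePow E (-(3 * m : ℤ)) := by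
    rw [mem_primePow, val_inv, hx, neg_neg, WithZero.exp_neg, inv_inv]
  refine ⟨4 * m, fixedVectors_ne_bot_of_weight hval _ _ (lowerElt hinv x y hxy)⁻¹ ?_⟩
  intro b hb
  obtain ⟨k, hk⟩ : ∃ k, k = ((lowerElt hinv x y hxy)⁻¹)⁻¹ * b.val * (lowerElt hinv x y hxy)⁻¹ :=
    ⟨_, rfl⟩
  rw [← hk] at hb
  have hbk : b.val = (lowerElt hinv x y hxy)⁻¹ * k * lowerElt hinv x y hxy := by
    rw [hk]
    group
  obtain ⟨k00, k01, k02, k10, k11, k12, k20, k21, k22⟩ := hb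
  push_cast at k00 k01 k02 k10 k11 k12 k20 k21 k22
  have hb10 : entry b.val 1 0 = 0 := b.2 1 0 (by decide)
  have he : ∀ i j, entry b.val i j = _ := fun i j => by rw [hbk, entry_mul]
  simp only [entry_mul, entry_inv, lowerElt, entry_ofMatrix] at he
  have e00 := he 0 0
  have e11 := he 1 1
  have e10 := he 1 0
  simp [Fin.rev, hinv] at e00 e11 e10
  -- Membership in `K_{4m}` only makes this entry integral. The vanishing of the `(1, 0)` entry of
  -- `b`, divided by `x`, ties it to the middle entry of `k` modulo `𝔭ᵐ`.
  have hk00 : entry k 0 0 - 1 ∈ primePow E m := by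
    have hx1 : x * x⁻¹ = 1 := mul_inv_cancel₀ hx0
    have h3 : entry k 0 0 - 1 = entry k 1 0 * x⁻¹ - x * entry k 0 1 + (entry k 1 1 - 1) -
        entry k 0 2 * y + entry k 1 2 * (y * x⁻¹) := by
      rw [hb10] at e10
      linear_combination x⁻¹ * e10 + (-entry k 0 0 - x * entry k 0 1 + entry k 1 1 -
        entry k 0 2 * y) * hx1
    rw [h3]
    exact add_mem_primePow (sub_mem_primePow (add_mem_primePow (sub_mem_primePow
      (mul_mem_primePow k10 hxi (by omega)) (mul_mem_primePow hxm k01 (by omega)))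
      (primePow_anti (by omega) k11)) (mul_mem_primePow k02 hym (by omega)))
      (mul_mem_primePow k12 (mul_mem_primePow hym hxi le_rfl) (by omega))
  have hb00 : entry b.val 0 0 - 1 ∈ primePow E m := by
    rw [show entry b.val 0 0 - 1 = (entry k 0 0 - 1) + entry k 0 1 * x + entry k 0 2 * y by
      rw [e00]; ring]
    exact add_mem_primePow (add_mem_primePow hk00 (mul_mem_primePow k01 hxm (by omega)))
      (mul_mem_primePow k02 hym (by omega))
  have hb11 : entry b.val 1 1 - 1 ∈ primePow E m := by
    rw [show entry b.val 1 1 - 1 = (entry k 1 1 - 1) - x * entry k 0 1 +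
      x * σ x * entry k 0 2 - entry k 1 2 * σ x by rw [e11]; ring]
    exact sub_mem_primePow (add_mem_primePow (sub_mem_primePow (primePow_anti (by omega) k11)
      (mul_mem_primePow hxm k01 (by omega)))
      (mul_mem_primePow (mul_mem_primePow hxm hσx le_rfl) k02 (by omega)))
      (mul_mem_primePow k12 hσx (by omega))
  rw [weight_tensorChar μ₁ μ₂ b (diagEntry σ 0 b) (midEntry σ b) rfl rfl
    (val_eq_one_of_sub_mem (by omega) hb00),
    H₁ (diagEntry σ 0 b) (primePow_anti (by omega) hb00),
    H₂ (midEntry σ b) (primePow_anti (by omega) hb11)]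
  simp

lemma trivialAtLevelZ_of_fixedVectors (hval : ∀ x, val E (σ x) = val E x) {V : Type*}
    [AddCommGroup V] [Module ℂ V] {π : Representation ℂ (unitaryG σ) V}
    {ω : Subgroup.center (unitaryG σ) →* ℂˣ} (hω : IsCentralCharacter π ω) {n : ℕ}
    (hn : fixedVectors π n ≠ ⊥) : TrivialAtLevelZ ω n := by
  obtain ⟨v, hv, hv0⟩ := (Submodule.ne_bot_iff _).1 hn
  rintro _ ⟨a, ha, rfl⟩
  have h := hω (iota σ a) v
  rw [hv _ (iota_mem_levelK hval ha)] at h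
  exact Units.ext (smul_left_injective ℂ hv0 (by simpa using h.symm))

lemma conductorZ_le_conductorRep (hval : ∀ x, val E (σ x) = val E x) {V : Type*}
    [AddCommGroup V] [Module ℂ V] {π : Representation ℂ (unitaryG σ) V}
    {ω : Subgroup.center (unitaryG σ) →* ℂˣ} (hω : IsCentralCharacter π ω)
    (hπ : AdmitsNewform π) : conductorZ ω ≤ conductorRep π :=
  Nat.sInf_le (trivialAtLevelZ_of_fixedVectors hval hω (Nat.sInf_mem hπ))

/-- If `μ₁` is unramified, the vector supported on `B K_n` for `n = c(μ₂)` is fixed. -/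
lemma fixedVectors_conductor₁_ne_bot (hval : ∀ x, val E (σ x) = val E x) {μ₁ : Eˣ →ₜ* ℂˣ}
    (hμ₁ : Unramified μ₁) {μ₂ : normOne σ →ₜ* ℂˣ} (hμ₂ : ∃ n, TrivialAtLevel₁ μ₂ n) :
    fixedVectors (parabolicInd (tensorChar μ₁ μ₂)) (conductor₁ μ₂) ≠ ⊥ := by
  rw [unramified_iff] at hμ₁
  refine fixedVectors_ne_bot_of_weight hval _ _ 1 fun b hb => ?_
  rw [inv_one, one_mul, mul_one] at hb
  obtain ⟨b00, -, -, -, b11, -, -, -, b22⟩ := hb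
  -- Both outer diagonal entries are integral, so this relation makes them units.
  have h1 : σ (entry b.val 0 0) * entry b.val 2 2 = 1 := by
    have := entry_form b.val 0 2
    rw [b.2 1 0 (by decide), b.2 2 0 (by decide)] at this
    simpa [formJ] using this
  have hv : val E (entry b.val 0 0) = 1 := by
    refine le_antisymm (mem_primePow_zero.1 b00) ?_
    have h2 := congrArg (val E) h1
    rw [val_mul, hval, val_one] at h2
    rw [← h2]
    exact mul_le_of_le_one_right zero_le (mem_primePow_zero.1 b22)
  rw [weight_tensorChar μ₁ μ₂ b (diagEntry σ 0 b) (midEntry σ b) rfl rfl hv, hμ₁ _ hv,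
    (show TrivialAtLevel₁ μ₂ (conductor₁ μ₂) from Nat.sInf_mem hμ₂) (midEntry σ b) (Or.inr b11)]
  simp

lemma conductorRep_eq_of_unramified (hval : ∀ x, val E (σ x) = val E x) {μ₁ : Eˣ →ₜ* ℂˣ}
    (hμ₁ : Unramified μ₁) {μ₂ : normOne σ →ₜ* ℂˣ} (hμ₂ : ∃ n, TrivialAtLevel₁ μ₂ n)
    {ω : Subgroup.center (unitaryG σ) →* ℂˣ}
    (hω : IsCentralCharacter (parabolicInd (tensorChar μ₁ μ₂)) ω) :
    conductorRep (parabolicInd (tensorChar μ₁ μ₂)) = conductor₁ μ₂ ∧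
      conductorZ ω = conductor₁ μ₂ := by
  have hne := fixedVectors_conductor₁_ne_bot hval hμ₁ hμ₂
  obtain ⟨f, -, hf⟩ := (Submodule.ne_bot_iff _).1 hne
  have hZ : conductorZ ω = conductor₁ μ₂ := by
    have : ∀ a : normOne σ, ω (iota σ a) = μ₂ a := fun a => by
      rw [centralCharacter_iota hval hω hf,
        (unramified_iff μ₁).1 hμ₁ a.val (val_eq_one_of_normOne hval a.2), one_mul]
    simp only [conductorZ, conductor₁, TrivialAtLevelZ, TrivialAtLevel₁, Set.forall_mem_image, this]
  refine ⟨le_antisymm (Nat.sInf_le hne) ?_, hZ⟩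
  rw [← hZ]
  exact conductorZ_le_conductorRep hval hω ⟨_, hne⟩

/-- Equality of conductors rules out a central character already trivial on `E¹_{n-1}`, so the
newform is nonzero at `1`. There the torus units in `K_n` test `μ₁`. -/
lemma unramified_of_conductorRep_eq (hinv : ∀ x, σ (σ x) = x)
    (hval : ∀ x, val E (σ x) = val E x) (h2 : val E (2 : E) = 1) {μ₁ : Eˣ →ₜ* ℂˣ}
    {μ₂ : normOne σ →ₜ* ℂˣ} {ω : Subgroup.center (unitaryG σ) →* ℂˣ}
    (hω : IsCentralCharacter (parabolicInd (tensorChar μ₁ μ₂)) ω)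
    (h : conductorRep (parabolicInd (tensorChar μ₁ μ₂)) = conductorZ ω) : Unramified μ₁ := by
  obtain ⟨f, hf, hf0⟩ := (Submodule.ne_bot_iff _).1
    (Nat.sInf_mem (admitsNewform_parabolicInd hinv hval h2 μ₁ μ₂))
  change f ∈ fixedVectors _ (conductorRep _) at hf
  rw [h] at hf
  obtain ⟨g, hg⟩ := exists_apply_ne_zero hf0
  rcases apply_one_ne_zero_or hinv hval h2 hf hg with h1 | ⟨hn, hZ⟩
  · rw [unramified_iff]
    intro a ha
    have hb : torusElt σ hinv a ∈ borelB σ := mem_borelB_of_last_row rfl rfl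
    have h3 := apply_mul_of_mem_fixedVectors hf
      (torusElt_mem_levelK hinv hval ha (conductorZ ω)) 1
    have h4 := apply_borel_mul f ⟨_, hb⟩ 1
    rw [one_mul] at h3
    rw [mul_one, h3, weight_tensorChar μ₁ μ₂ _ a 1 rfl rfl ha, map_one, Units.val_one,
      mul_one] at h4
    exact Units.ext (mul_right_cancel₀ h1 (h4.symm.trans (one_mul _).symm))
  · have : conductorZ ω ≤ conductorZ ω - 1 := by
      refine Nat.sInf_le ?_
      rintro _ ⟨a, ha, rfl⟩
      rw [centralCharacter_iota hval hω hf0, hZ a ha]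
    omega

end Conductor

end UnramifiedU3

theorem proposition2p5
    {F E : Type*}
    [Field F] [ValuativeRel F] [TopologicalSpace F] [IsNonarchimedeanLocalField F] [CharZero F]
    (hF : ringChar 𝓀[F] ≠ 2)
    [Field E] [ValuativeRel E] [TopologicalSpace E] [IsNonarchimedeanLocalField E]
    [Algebra F E] [ValuativeExtension F E]
    (ε : F) (hε : valuation F ε = 1) (hε' : ¬ IsSquare ε)
    (s : E) (hs : s ^ 2 = algebraMap F E ε) (hE : IntermediateField.adjoin F {s} = ⊤)
    (σ : E ≃ₐ[F] E) (hσ : σ ≠ AlgEquiv.refl)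
    (μ₁ : Eˣ →ₜ* ℂˣ) (μ₂ : normOne σ →ₜ* ℂˣ) :
    -- the conductors are minima of non-empty sets, and the central character exists
    (∃ n, TrivialAtLevel μ₁ n) ∧ (∃ n, TrivialAtLevel₁ μ₂ n) ∧
    AdmitsNewform (parabolicInd (tensorChar μ₁ μ₂)) ∧
    (∃! ω, IsCentralCharacter (parabolicInd (tensorChar μ₁ μ₂)) ω) ∧
    ∀ ω, IsCentralCharacter (parabolicInd (tensorChar μ₁ μ₂)) ω →
      (∃ n, TrivialAtLevelZ ω n) ∧
      (conductorRep (parabolicInd (tensorChar μ₁ μ₂)) = conductorZ ω ↔ Unramified μ₁) ∧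
      (Unramified μ₁ →
        conductorRep (parabolicInd (tensorChar μ₁ μ₂)) = conductor₁ μ₂ ∧
        conductorZ ω = conductor₁ μ₂) := by
  have hinv : ∀ x, σ (σ x) = x := conj_conj hs hE hσ
  have hval : ∀ x, val E (σ x) = val E x := val_conj hε hε' hs hE hσ
  have h2 : val E (2 : E) = 1 := val_two hF
  have h20 : (2 : E) ≠ 0 := by
    intro h
    simp [h] at h2
  have hnew := admitsNewform_parabolicInd hinv hval h2 μ₁ μ₂
  obtain ⟨m₁, -, H₁⟩ := exists_trivialAtLevel μ₁
  obtain ⟨m₂, hm₂, H₂⟩ := exists_trivialAtLevel₁ μ₂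
  -- As `m₂ ≥ 1`, the exceptional clause making `E¹_0` all of `E¹` does not apply.
  have hμ₂ : ∃ n, TrivialAtLevel₁ μ₂ n :=
    ⟨m₂, fun b hb => H₂ b (hb.resolve_left (by omega))⟩
  obtain ⟨n, hn⟩ := id hnew
  obtain ⟨f, -, hf⟩ := (Submodule.ne_bot_iff _).1 hn
  refine ⟨⟨m₁, fun a _ ha => H₁ a ha⟩, hμ₂, hnew,
    existsUnique_centralCharacter hinv hval h20 μ₁ μ₂ hf, fun ω hω => ?_⟩
  refine ⟨⟨n, trivialAtLevelZ_of_fixedVectors hval hω hn⟩,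
    ⟨unramified_of_conductorRep_eq hinv hval h2 hω, fun hμ₁ => ?_⟩,
    fun hμ₁ => conductorRep_eq_of_unramified hval hμ₁ hμ₂ hω⟩
  obtain ⟨hN, hZ⟩ := conductorRep_eq_of_unramified hval hμ₁ hμ₂ hω
  rw [hN, hZ]
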